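/- Let $L$ be a non-negative self-adjoint (in general unbounded) operator in a complex Hilbert space $\mathbf H$, and let $\sqrt L$ be its non-negative self-adjoint square root. For $r\in\mathbb N$ let $\mathbf H^r$ be the domain of $L^{r/2}=(\sqrt L)^r$ with the norm $\|f\|_{\mathbf H^r}=\|f\|+\|L^{r/2}f\|$, and put $$K(f,t)=\inf\{\|f_0\|+t\|f_1\|_{\mathbf H^r} : f=f_0+f_1,\ f_0\in\mathbf H,\ f_1\in\mathbf H^r\},\qquad f\in\mathbf H,\ t>0 .$$ For $\alpha>0$, $1\le q\le\infty$ and a natural number $r>\alpha$, the Besov space $\mathcal B^\alpha_{\mathbf H,q}(\sqrt L)=(\mathbf H,\mathbf H^r)^K_{\alpha/r,q}$ is the set of all $f\in\mathbf H$ with $$\|f\|_{\mathcal B^\alpha_{\mathbf H,q}}=\Big(\int_0^\infty \big(t^{-\alpha/r}K(f,t)\big)^q\,\frac{dt}{t}\Big)^{1/q}<\infty ,$$ where for $q=\infty$ the integral is replaced by $\sup_{t>0}t^{-\alpha/r}K(f,t)$. Let $g\in C^\infty([0,\infty))$ be real-valued and non-increasing, with $g=1$ on $[0,1]$ and $\operatorname{supp}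 g\subset[0,2]$. Put $h(\lambda)=g(\lambda)-g(2\lambda)$, $F_0(\lambda)=\sqrt{g(\lambda)}$, and $F_j(\lambda)=\sqrt{h(2^{-j}\lambda)}$ for $j\ge1$, so that $\sum_{j\ge0}F_j^2=1$ on $[0,\infty)$. Let $F_j(\sqrt L)$ be the bounded operators given by the functional calculus of $\sqrt L$. **Theorem 7.4.** For every $\alpha>0$, $1\le q\le\infty$ and natural number $r>\alpha$, a vector $f\in\mathbf H$ belongs to $\mathcal B^\alpha_{\mathbf H,q}(\sqrt L)$ if and only if $$\Big(\sum_{j=0}^\infty\big(2^{j\alpha}\|F_j(\sqrt L)f\|\big)^q\Big)^{1/q}<\infty$$ (for $q=\infty$: $\sup_{j\ge0}2^{j\alpha}\|F_j(\sqrt L)f\|<\infty$), and this expression is equivalent to the norm $\|\cdot\|_{\mathcal B^\alpha_{\mathbf H,q}}$: there are constants $c,C>0$, independent of $f$, with $$c\,\|f\|_{\mathcal B^\alpha_{\mathbf H,q}}\le\Big(\sum_{j=0}^\infty\big(2^{j\alpha}\|F_j(\sqrt L)f\|\big)^q\Big)^{1/q}\le C\,\|f\|_{\mathcal B^\alpha_{\mathbf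 H,q}},\qquad f\in\mathcal B^\alpha_{\mathbf H,q}(\sqrt L).$$ -/

import Mathlib

open scoped ENNReal

namespace SpectralBesov

section Composition

variable {H : Type*} [NormedAddCommGroup H] [InnerProductSpace ℂ H]

/-- The composition `S ∘ T` of partially defined operators, with its natural domain
`{x ∈ D(T) | T x ∈ D(S)}`. -/
def compOp (S T : H →ₗ.[ℂ] H) : H →ₗ.[ℂ] H :=
  S.comp (T.domRestrict ((S.domain.comap T.toFun).map T.domain.subtype)) (by
    rintro ⟨x, hx1, hx2⟩
    obtain ⟨x', h1, rfl⟩ := hx1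
    exact h1)

theorem mem_graph_compOp (S T : H →ₗ.[ℂ] H) (x z : H) :
    (x, z) ∈ (compOp S T).graph ↔ ∃ y, (x, y) ∈ T.graph ∧ (y, z) ∈ S.graph := by
  simp only [LinearPMap.mem_graph_iff]
  constructor
  · rintro ⟨u, rfl, rfl⟩
    exact ⟨T ⟨u, u.2.2⟩, ⟨⟨u, u.2.2⟩, rfl, rfl⟩, ⟨_, _⟩, rfl, rfl⟩
  · rintro ⟨y, ⟨t, rfl, rfl⟩, ⟨s, hs, rfl⟩⟩
    refine ⟨⟨t, ⟨⟨t, ?_, rfl⟩, t.2⟩⟩, rfl, ?_⟩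
    · change T t ∈ S.domain
      rw [← hs]; exact s.2
    · change S ⟨T t, _⟩ = S s
      congr 1
      exact Subtype.ext hs.symm

/-- The powers `S ^ k` of a partially defined operator, with their natural domains. -/
def powOp (S : H →ₗ.[ℂ] H) : ℕ → (H →ₗ.[ℂ] H)
  | 0 => LinearMap.id.toPMap ⊤
  | k + 1 => compOp S (powOp S k)

/-- The norm `‖f‖ + ‖S ^ k f‖` of the domain of `S ^ k`, with the value `∞` for the vectors `f`
which are not in this domain. For `S = √L` this is the norm of `H ^ k`, the domain of
`L ^ (k / 2) = (√L) ^ k`. -/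
noncomputable def graphENorm (S : H →ₗ.[ℂ] H) (k : ℕ) (f : H) : ℝ≥0∞ :=
  ⨅ hf : f ∈ (powOp S k).domain, (‖f‖ₑ + ‖powOp S k ⟨f, hf⟩‖ₑ)

end Composition

section Operators

variable {H : Type*} [NormedAddCommGroup H] [InnerProductSpace ℂ H] [CompleteSpace H]

/-- `L` is a non-negative self-adjoint operator, in general unbounded, in the Hilbert space `H`. -/
structure IsNonnegSelfAdjoint (L : H →ₗ.[ℂ] H) : Prop where
  isSelfAdjoint : IsSelfAdjoint L
  nonneg : ∀ x : L.domain, 0 ≤ (inner ℂ (L x) (x : H)).re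

theorem IsNonnegSelfAdjoint.isFormalAdjoint {L : H →ₗ.[ℂ] H} (hL : IsNonnegSelfAdjoint L) :
    L.IsFormalAdjoint L := by
  have h := LinearPMap.adjoint_isFormalAdjoint hL.isSelfAdjoint.dense_domain
  rwa [LinearPMap.isSelfAdjoint_def.1 hL.isSelfAdjoint] at h

theorem IsNonnegSelfAdjoint.norm_le {L : H →ₗ.[ℂ] H} (hL : IsNonnegSelfAdjoint L) (x : L.domain) :
    ‖(x : H)‖ ≤ ‖(x : H) + L x‖ := by
  have h1 : ‖(x : H)‖ ^ 2 ≤ (inner ℂ ((x : H) + L x) (x : H)).re := by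
    rw [inner_add_left, Complex.add_re]
    have := hL.nonneg x
    have h2 : (inner ℂ (x : H) (x : H)).re = ‖(x : H)‖ ^ 2 := inner_self_eq_norm_sq (𝕜 := ℂ) _
    linarith
  have h3 : (inner ℂ ((x : H) + L x) (x : H)).re ≤ ‖(x : H) + L x‖ * ‖(x : H)‖ :=
    (Complex.re_le_norm _).trans (norm_inner_le_norm _ _)
  by_contra! h
  nlinarith [norm_nonneg ((x : H) + L x), norm_nonneg (x : H)]

/-- For a non-negative self-adjoint `L`, the operator `1 + L` maps the domain of `L` onto `H`. -/
theorem IsNonnegSelfAdjoint.surjective {L : H →ₗ.[ℂ] H} (hL : IsNonnegSelfAdjoint L) (y : H) :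
    ∃ x : L.domain, (x : H) + L x = y := by
  set A : L.domain →ₗ[ℂ] H := L.domain.subtype + L.toFun with hA
  have hAx : ∀ x : L.domain, A x = (x : H) + L x := fun x => rfl
  have hclosed : IsClosed (LinearMap.range A : Set H) := by
    apply isClosed_of_closure_subset
    intro z hz
    obtain ⟨u, hu, hlim⟩ := mem_closure_iff_seq_limit.1 hz
    choose v hv using hu
    have hcu : CauchySeq u := hlim.cauchySeq
    have hcv : CauchySeq (fun n => (v n : H)) := by
      rw [Metric.cauchySeq_iff] at hcu ⊢
      intro ε hε
      obtain ⟨N, hN⟩ := hcu ε hε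
      refine ⟨N, fun m hm n hn => lt_of_le_of_lt ?_ (hN m hm n hn)⟩
      rw [dist_eq_norm, dist_eq_norm, ← hv, ← hv, ← map_sub, hAx]
      exact hL.norm_le (v m - v n)
    obtain ⟨x, hx⟩ := cauchySeq_tendsto_of_complete hcv
    have hLv : Filter.Tendsto (fun n => L (v n)) Filter.atTop (nhds (z - x)) := by
      refine (hlim.sub hx).congr fun n => ?_
      rw [← hv, hAx]; abel
    have hmem : (x, z - x) ∈ (L.graph : Set (H × H)) := by
      have hc : IsClosed (L.graph : Set (H × H)) := hL.isSelfAdjoint.isClosed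
      exact hc.mem_of_tendsto (hx.prodMk_nhds hLv)
        (Filter.Eventually.of_forall fun n => L.mem_graph (v n))
    obtain ⟨x', h1, h2⟩ := (LinearPMap.mem_graph_iff L).1 hmem
    refine ⟨x', ?_⟩
    rw [hAx, h2, h1]
    simp
  have htop : LinearMap.range A = ⊤ := by
    have : CompleteSpace (LinearMap.range A) := hclosed.completeSpace_coe
    rw [← Submodule.orthogonal_eq_bot_iff, Submodule.eq_bot_iff]
    intro w hw
    rw [Submodule.mem_orthogonal'] at hw
    have hw' : ∀ x : L.domain, inner ℂ (-w) (x : H) = inner ℂ w (L x) := by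
      intro x
      have := hw (A x) ⟨x, rfl⟩
      rw [hAx, inner_add_right] at this
      rw [inner_neg_left]
      linear_combination -this
    have hdom := LinearPMap.mem_adjoint_domain_of_exists (T := L) w ⟨-w, hw'⟩
    have hval := LinearPMap.adjoint_apply_eq hL.isSelfAdjoint.dense_domain ⟨w, hdom⟩ hw'
    have hgr : (w, -w) ∈ L.adjoint.graph := (LinearPMap.mem_graph_iff _).2 ⟨⟨w, hdom⟩, rfl, hval⟩
    rw [LinearPMap.isSelfAdjoint_def.1 hL.isSelfAdjoint] at hgr
    obtain ⟨w', h1, h2⟩ := (LinearPMap.mem_graph_iff L).1 hgr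
    have := hL.norm_le w'
    rw [h2, h1] at this
    simpa using this
  have : y ∈ LinearMap.range A := htop ▸ Submodule.mem_top
  obtain ⟨x, hx⟩ := this
  exact ⟨x, hx⟩

theorem IsNonnegSelfAdjoint.exists_resolvent {L : H →ₗ.[ℂ] H} (hL : IsNonnegSelfAdjoint L) :
    ∃ R : H →L[ℂ] H, ∀ y : H, ∃ x : L.domain, (x : H) = R y ∧ (x : H) + L x = y := by
  choose v hv using hL.surjective
  have huniq : ∀ x x' : L.domain, (x : H) + L x = x' + L x' → x = x' := by
    intro x x' h
    have h1 := hL.norm_le (x - x')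
    have h2 : ((x - x' : L.domain) : H) + L (x - x') = 0 := by
      rw [LinearPMap.map_sub, Submodule.coe_sub]
      rw [← sub_eq_zero] at h
      rw [← h]; abel
    rw [h2, norm_zero, norm_le_zero_iff] at h1
    exact sub_eq_zero.1 (Subtype.ext h1)
  let R₀ : H →ₗ[ℂ] H :=
    { toFun := fun y => (v y : H)
      map_add' := fun y z => by
        rw [← Submodule.coe_add]
        congr 1
        apply huniq
        rw [hv, LinearPMap.map_add, Submodule.coe_add]
        nth_rewrite 1 [← hv y, ← hv z]
        abel
      map_smul' := fun c y => by
        rw [RingHom.id_apply, ← Submodule.coe_smul]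
        congr 1
        apply huniq
        rw [hv, LinearPMap.map_smul, Submodule.coe_smul, ← smul_add, hv] }
  refine ⟨R₀.mkContinuous 1 fun y => ?_, fun y => ⟨v y, rfl, hv y⟩⟩
  have := hL.norm_le (v y)
  rw [hv] at this
  rw [one_mul]
  exact this

/-- The resolvent `(1 + L)⁻¹`, an everywhere defined bounded operator. -/
noncomputable def resolvent (L : H →ₗ.[ℂ] H) (hL : IsNonnegSelfAdjoint L) : H →L[ℂ] H :=
  hL.exists_resolvent.choose

/-- `resolvent L hL` is a right inverse of `1 + L`. -/
theorem resolvent_spec (L : H →ₗ.[ℂ] H) (hL : IsNonnegSelfAdjoint L) (y : H) :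
    ∃ x : L.domain, (x : H) = resolvent L hL y ∧ (x : H) + L x = y :=
  hL.exists_resolvent.choose_spec y

/-- `resolvent L hL` is a left inverse of `1 + L`. -/
theorem resolvent_apply (L : H →ₗ.[ℂ] H) (hL : IsNonnegSelfAdjoint L) (x : L.domain) :
    resolvent L hL ((x : H) + L x) = x := by
  obtain ⟨x', h1, h2⟩ := resolvent_spec L hL ((x : H) + L x)
  have h3 := hL.norm_le (x' - x)
  have h4 : ((x' - x : L.domain) : H) + L (x' - x) = 0 := by
    rw [LinearPMap.map_sub, Submodule.coe_sub]
    rw [← sub_eq_zero] at h2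
    rw [← h2]; abel
  rw [h4, norm_zero, norm_le_zero_iff] at h3
  rw [← h1, sub_eq_zero.1 (Subtype.ext h3 : x' - x = 0)]

theorem resolvent_injective (L : H →ₗ.[ℂ] H) (hL : IsNonnegSelfAdjoint L) :
    Function.Injective (resolvent L hL) := by
  intro y z h
  obtain ⟨x, h1, h2⟩ := resolvent_spec L hL y
  obtain ⟨x', h1', h2'⟩ := resolvent_spec L hL z
  have : x = x' := Subtype.ext (by rw [h1, h1', h])
  rw [← h2, ← h2', this]

theorem resolvent_isPositive (L : H →ₗ.[ℂ] H) (hL : IsNonnegSelfAdjoint L) :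
    (resolvent L hL).IsPositive := by
  rw [ContinuousLinearMap.isPositive_iff_complex]
  intro y
  obtain ⟨x, h1, h2⟩ := resolvent_spec L hL y
  have hsym : inner ℂ (x : H) (L x) = inner ℂ (L x) (x : H) := (hL.isFormalAdjoint x x).symm
  have him : (inner ℂ (L x) (x : H)).im = 0 := by
    have := inner_conj_symm (𝕜 := ℂ) (x : H) (L x)
    rw [hsym] at this
    exact Complex.conj_eq_iff_im.1 this
  have hxx : inner ℂ (x : H) (x : H) = ((‖(x : H)‖ ^ 2 : ℝ) : ℂ) := by
    rw [inner_self_eq_norm_sq_to_K]; norm_cast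
  have key : inner ℂ (resolvent L hL y) y
      = ((‖(x : H)‖ ^ 2 + (inner ℂ (L x) (x : H)).re : ℝ) : ℂ) := by
    rw [← h1, ← h2, inner_add_right, hsym, hxx]
    apply Complex.ext <;> simp [him]
  rw [key]
  refine ⟨rfl, ?_⟩
  have := hL.nonneg x
  simp only [RCLike.re_eq_complex_re, Complex.ofReal_re]
  positivity

theorem resolvent_isSelfAdjoint (L : H →ₗ.[ℂ] H) (hL : IsNonnegSelfAdjoint L) :
    IsSelfAdjoint (resolvent L hL) := (resolvent_isPositive L hL).isSelfAdjoint

theorem resolvent_norm_le (L : H →ₗ.[ℂ] H) (hL : IsNonnegSelfAdjoint L) :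
    ‖resolvent L hL‖ ≤ 1 := by
  refine ContinuousLinearMap.opNorm_le_bound _ zero_le_one fun y => ?_
  obtain ⟨x, h1, h2⟩ := resolvent_spec L hL y
  have := hL.norm_le x
  rwa [h1, ← h1, h2, h1, ← one_mul ‖y‖] at this

theorem resolvent_spectrum (L : H →ₗ.[ℂ] H) (hL : IsNonnegSelfAdjoint L) :
    spectrum ℝ (resolvent L hL) ⊆ Set.Icc 0 1 := by
  intro s hs
  refine ⟨spectrum_nonneg_of_nonneg
    ((ContinuousLinearMap.nonneg_iff_isPositive _).2 (resolvent_isPositive L hL)) hs, ?_⟩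
  rcases subsingleton_or_nontrivial H with h | h
  · have : Subsingleton (H →L[ℂ] H) := inferInstance
    simp [spectrum.of_subsingleton] at hs
  · exact (le_abs_self s).trans ((spectrum.norm_le_norm_of_mem hs).trans (resolvent_norm_le L hL))


/-- The functional calculus `F ↦ F(L)` for continuous functions `F : [0, ∞) → ℝ` which tend to `0`
at infinity. It is the continuous functional calculus of the bounded self-adjoint operator
`(1 + L)⁻¹`, whose spectrum is contained in `[0, 1]`, after the change of variable
`s = 1 / (1 + l)`, that is `l = s⁻¹ - 1`, which maps `l ∈ [0, ∞)` to `s ∈ (0, 1]`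
and `l = ∞` to `s = 0`. -/
noncomputable def funcCalc (L : H →ₗ.[ℂ] H) (hL : IsNonnegSelfAdjoint L) (F : ℝ → ℝ) : H →L[ℂ] H :=
  cfc (fun s : ℝ => if s = 0 then 0 else F (s⁻¹ - 1)) (resolvent L hL)

/-- The change of variable used in `funcCalc` produces a continuous function on `[0, 1]`. -/
theorem continuousOn_changeOfVariable {F : ℝ → ℝ} (hF : ContinuousOn F (Set.Ici 0))
    (h0 : Filter.Tendsto F Filter.atTop (nhds 0)) :
    ContinuousOn (fun s : ℝ => if s = 0 then 0 else F (s⁻¹ - 1)) (Set.Icc 0 1) := by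
  intro s hs
  rcases hs.1.eq_or_lt with rfl | hpos
  · rw [← continuousWithinAt_sdiff_self]
    have hsub : Set.Icc (0 : ℝ) 1 \ {0} ⊆ Set.Ioi 0 := fun t ht =>
      lt_of_le_of_ne ht.1.1 (Ne.symm ht.2)
    refine ContinuousWithinAt.mono ?_ hsub
    rw [ContinuousWithinAt, if_pos rfl]
    have h1 : Filter.Tendsto (fun t : ℝ => t⁻¹ - 1) (nhdsWithin 0 (Set.Ioi 0)) Filter.atTop :=
      Filter.tendsto_atTop_add_const_right _ (-1) tendsto_inv_nhdsGT_zero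
    refine (h0.comp h1).congr' ?_
    filter_upwards [self_mem_nhdsWithin] with t ht
    rw [if_neg (ne_of_gt ht), Function.comp]
  · have h1 : ContinuousWithinAt (fun t : ℝ => F (t⁻¹ - 1)) (Set.Icc 0 1 ∩ Set.Ioi 0) s := by
      refine ContinuousWithinAt.comp (t := Set.Ici 0) (hF _ ?_) ?_ ?_
      · exact sub_nonneg.2 ((one_le_inv₀ hpos).2 hs.2)
      · exact ((continuousAt_inv₀ hpos.ne').sub continuousAt_const).continuousWithinAt
      · exact fun t ht => sub_nonneg.2 ((one_le_inv₀ ht.2).2 ht.1.2)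
    rw [← continuousWithinAt_inter (Ioi_mem_nhds hpos)]
    refine h1.congr (fun t ht => if_neg (ne_of_gt ht.2)) (if_neg hpos.ne')

/-- `funcCalc` sends `l ↦ 1 / (1 + l)` to the resolvent `(1 + L)⁻¹`. -/
theorem funcCalc_resolvent (L : H →ₗ.[ℂ] H) (hL : IsNonnegSelfAdjoint L) :
    funcCalc L hL (fun l => (1 + l)⁻¹) = resolvent L hL := by
  rw [funcCalc]
  conv_rhs => rw [← cfc_id' ℝ (resolvent L hL) (resolvent_isSelfAdjoint L hL)]
  refine cfc_congr fun s _ => ?_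
  by_cases h : s = 0 <;> simp [h]

/-- `funcCalc` is multiplicative. -/
theorem funcCalc_mul (L : H →ₗ.[ℂ] H) (hL : IsNonnegSelfAdjoint L) {F G : ℝ → ℝ}
    (hF : ContinuousOn F (Set.Ici 0)) (hF0 : Filter.Tendsto F Filter.atTop (nhds 0))
    (hG : ContinuousOn G (Set.Ici 0)) (hG0 : Filter.Tendsto G Filter.atTop (nhds 0)) :
    funcCalc L hL (fun l => F l * G l) = funcCalc L hL F * funcCalc L hL G := by
  have hsub := resolvent_spectrum L hL
  rw [funcCalc, funcCalc, funcCalc,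
    ← cfc_mul _ _ _ ((continuousOn_changeOfVariable hF hF0).mono hsub)
      ((continuousOn_changeOfVariable hG hG0).mono hsub)]
  refine cfc_congr fun s _ => ?_
  by_cases h : s = 0 <;> simp [h]

/-- `funcCalc` is additive. -/
theorem funcCalc_add (L : H →ₗ.[ℂ] H) (hL : IsNonnegSelfAdjoint L) {F G : ℝ → ℝ}
    (hF : ContinuousOn F (Set.Ici 0)) (hF0 : Filter.Tendsto F Filter.atTop (nhds 0))
    (hG : ContinuousOn G (Set.Ici 0)) (hG0 : Filter.Tendsto G Filter.atTop (nhds 0)) :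
    funcCalc L hL (fun l => F l + G l) = funcCalc L hL F + funcCalc L hL G := by
  have hsub := resolvent_spectrum L hL
  rw [funcCalc, funcCalc, funcCalc,
    ← cfc_add _ _ _ ((continuousOn_changeOfVariable hF hF0).mono hsub)
      ((continuousOn_changeOfVariable hG hG0).mono hsub)]
  refine cfc_congr fun s _ => ?_
  by_cases h : s = 0 <;> simp [h]

/-- The bounded operator `(1 + L) ^ (-1/2)`. -/
noncomputable def resolventRoot (L : H →ₗ.[ℂ] H) (hL : IsNonnegSelfAdjoint L) : H →L[ℂ] H :=
  cfc (fun s : ℝ => √s) (resolvent L hL)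

/-- The bounded operator `(L (1 + L)⁻¹) ^ (1/2) = (1 - (1 + L)⁻¹) ^ (1/2)`. -/
noncomputable def coresolventRoot (L : H →ₗ.[ℂ] H) (hL : IsNonnegSelfAdjoint L) : H →L[ℂ] H :=
  cfc (fun s : ℝ => √(1 - s)) (resolvent L hL)

/-- The non-negative self-adjoint square root of `L`: its domain is the range of
`(1 + L) ^ (-1/2)`, and it maps `(1 + L) ^ (-1/2) h` to `(L (1 + L)⁻¹) ^ (1/2) h`. -/
noncomputable def sqrtOp (L : H →ₗ.[ℂ] H) (hL : IsNonnegSelfAdjoint L) : H →ₗ.[ℂ] H :=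
  (coresolventRoot L hL).toLinearMap.compPMap
    ((resolventRoot L hL).toLinearMap.toPMap ⊤).inverse

theorem resolventRoot_mul_self (L : H →ₗ.[ℂ] H) (hL : IsNonnegSelfAdjoint L) :
    resolventRoot L hL * resolventRoot L hL = resolvent L hL := by
  have hR := resolvent_isSelfAdjoint L hL
  rw [resolventRoot, ← cfc_mul _ _ _ (by fun_prop) (by fun_prop)]
  conv_rhs => rw [← cfc_id' ℝ (resolvent L hL) hR]
  exact cfc_congr fun s hs => Real.mul_self_sqrt (resolvent_spectrum L hL hs).1

theorem coresolventRoot_mul_self (L : H →ₗ.[ℂ] H) (hL : IsNonnegSelfAdjoint L) :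
    coresolventRoot L hL * coresolventRoot L hL = 1 - resolvent L hL := by
  have hR := resolvent_isSelfAdjoint L hL
  rw [coresolventRoot, ← cfc_mul _ _ _ (by fun_prop) (by fun_prop)]
  conv_rhs => rw [← cfc_id' ℝ (resolvent L hL) hR, ← cfc_const_one ℝ (resolvent L hL) hR,
    ← cfc_sub _ _ _ (by fun_prop) (by fun_prop)]
  exact cfc_congr fun s hs =>
    Real.mul_self_sqrt (sub_nonneg.2 (resolvent_spectrum L hL hs).2)

theorem resolventRoot_comm (L : H →ₗ.[ℂ] H) (hL : IsNonnegSelfAdjoint L) :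
    resolventRoot L hL * coresolventRoot L hL = coresolventRoot L hL * resolventRoot L hL :=
  cfc_commute_cfc _ _ _

theorem resolventRoot_isSelfAdjoint (L : H →ₗ.[ℂ] H) (hL : IsNonnegSelfAdjoint L) :
    IsSelfAdjoint (resolventRoot L hL) := cfc_predicate _ _

theorem coresolventRoot_isSelfAdjoint (L : H →ₗ.[ℂ] H) (hL : IsNonnegSelfAdjoint L) :
    IsSelfAdjoint (coresolventRoot L hL) := cfc_predicate _ _

theorem resolventRoot_injective (L : H →ₗ.[ℂ] H) (hL : IsNonnegSelfAdjoint L) :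
    Function.Injective (resolventRoot L hL) := by
  intro x y h
  apply resolvent_injective L hL
  rw [← resolventRoot_mul_self, mul_apply_eq_comp, mul_apply_eq_comp, h]

theorem mem_graph_sqrtOp (L : H →ₗ.[ℂ] H) (hL : IsNonnegSelfAdjoint L) (x y : H) :
    (x, y) ∈ (sqrtOp L hL).graph ↔
      ∃ h : H, resolventRoot L hL h = x ∧ coresolventRoot L hL h = y := by
  set P := (resolventRoot L hL).toLinearMap.toPMap ⊤ with hP
  have hker : LinearMap.ker P.toFun = ⊥ := by
    rw [LinearMap.ker_eq_bot]
    intro u v huv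
    exact Subtype.ext (resolventRoot_injective L hL huv)
  have hinv : ∀ h : H, (resolventRoot L hL h, h) ∈ P.inverse.graph := fun h =>
    LinearPMap.mem_inverse_graph hker ⟨h, Submodule.mem_top⟩
  rw [LinearPMap.mem_graph_iff]
  constructor
  · rintro ⟨u, rfl, rfl⟩
    have hu : (u : H) ∈ P.inverse.domain := u.2
    rw [LinearPMap.inverse_domain] at hu
    obtain ⟨h, hh⟩ := hu
    have hh' : resolventRoot L hL (h : H) = u := hh
    have h1 := hinv h
    rw [hh'] at h1
    have h2 := LinearPMap.mem_graph_snd_inj P.inverse h1 (P.inverse.mem_graph u) rfl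
    exact ⟨h, hh', congrArg (coresolventRoot L hL) h2⟩
  · rintro ⟨h, rfl, rfl⟩
    obtain ⟨u, h1, h2⟩ := (LinearPMap.mem_graph_iff _).1 (hinv h)
    exact ⟨u, h1, congrArg (coresolventRoot L hL) h2⟩

theorem resolventRoot_decomp (L : H →ₗ.[ℂ] H) (hL : IsNonnegSelfAdjoint L) (x : H) :
    resolventRoot L hL (resolventRoot L hL x) + coresolventRoot L hL (coresolventRoot L hL x)
      = x := by
  have h1 := congrArg (fun T => T x) (resolventRoot_mul_self L hL)
  have h2 := congrArg (fun T => T x) (coresolventRoot_mul_self L hL)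
  simp only [mul_apply_eq_comp, sub_apply,
    one_apply_eq_self] at h1 h2
  rw [h1, h2]; abel

theorem sqrtOp_isNonnegSelfAdjoint (L : H →ₗ.[ℂ] H) (hL : IsNonnegSelfAdjoint L) :
    IsNonnegSelfAdjoint (sqrtOp L hL) := by
  set P := resolventRoot L hL with hP
  set Q := coresolventRoot L hL with hQ
  have hPs : ∀ x y, inner ℂ (P x) y = inner ℂ x (P y) :=
    (resolventRoot_isSelfAdjoint L hL).isSymmetric
  have hQs : ∀ x y, inner ℂ (Q x) y = inner ℂ x (Q y) :=
    (coresolventRoot_isSelfAdjoint L hL).isSymmetric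
  have hPQ : ∀ x, P (Q x) = Q (P x) := fun x =>
    congrArg (fun T => T x) (resolventRoot_comm L hL)
  have hgr := mem_graph_sqrtOp L hL
  have hdec := resolventRoot_decomp L hL
  have hinj := resolventRoot_injective L hL
  rw [← hP, ← hQ] at *
  have hdom : ∀ h, P h ∈ (sqrtOp L hL).domain := fun h =>
    LinearPMap.mem_domain_of_mem_graph ((hgr (P h) (Q h)).2 ⟨h, rfl, rfl⟩)
  have hdense : Dense ((sqrtOp L hL).domain : Set H) := by
    rw [Submodule.dense_iff_topologicalClosure_eq_top,
      Submodule.topologicalClosure_eq_top_iff, Submodule.eq_bot_iff]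
    intro w hw
    rw [Submodule.mem_orthogonal'] at hw
    have : P w = 0 := by
      apply ext_inner_right ℂ
      intro v
      rw [hPs, hw _ (hdom v), inner_zero_left]
    exact hinj (this.trans (map_zero P).symm)
  refine ⟨?_, ?_⟩
  · rw [LinearPMap.isSelfAdjoint_def]
    apply LinearPMap.eq_of_eq_graph
    rw [LinearPMap.adjoint_graph_eq_graph_adjoint hdense]
    ext ⟨y, w⟩
    rw [Submodule.mem_adjoint_iff, hgr]
    simp only [hgr]
    constructor
    · intro h
      have hPw : P w = Q y := by
        apply ext_inner_left ℂ
        intro v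
        have := h (P v) (Q v) ⟨v, rfl, rfl⟩
        rw [← hPs, ← hQs, ← sub_eq_zero, ← neg_sub, this, neg_zero]
      have hy : P (P y + Q w) = y := by
        rw [map_add, hPQ, hPw, hdec]
      refine ⟨P y + Q w, hy, ?_⟩
      apply hinj
      rw [hPQ, hy, hPw]
    · rintro ⟨u, rfl, rfl⟩ a b ⟨v, rfl, rfl⟩
      rw [hPs, hQs, hPQ, sub_self]
  · intro x
    obtain ⟨h, h1, h2⟩ := (hgr _ _).1 ((sqrtOp L hL).mem_graph x)
    rw [← h2, ← h1]
    have hpos : (0 : H →L[ℂ] H) ≤ P * Q := by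
      change 0 ≤ cfc (fun s : ℝ => √s) (resolvent L hL) *
        cfc (fun s : ℝ => √(1 - s)) (resolvent L hL)
      rw [← cfc_mul _ _ _ (by fun_prop) (by fun_prop)]
      exact cfc_nonneg fun s _ => by positivity
    rw [ContinuousLinearMap.nonneg_iff_isPositive] at hpos
    have := hpos.re_inner_nonneg_left h
    rw [mul_apply_eq_comp, hPs] at this
    exact this

/-- The square of `sqrtOp L hL` is `L`, domains included. -/
theorem powOp_sqrtOp_two (L : H →ₗ.[ℂ] H) (hL : IsNonnegSelfAdjoint L) :
    powOp (sqrtOp L hL) 2 = L := by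
  set P := resolventRoot L hL with hP
  set Q := coresolventRoot L hL with hQ
  have hPQ : ∀ x, P (Q x) = Q (P x) := fun x =>
    congrArg (fun T => T x) (resolventRoot_comm L hL)
  have hgr := mem_graph_sqrtOp L hL
  have hdec := resolventRoot_decomp L hL
  have hinj := resolventRoot_injective L hL
  have hPP : ∀ x, P (P x) = resolvent L hL x := fun x =>
    congrArg (fun T => T x) (resolventRoot_mul_self L hL)
  have hQQ : ∀ x, Q (Q x) = x - resolvent L hL x := fun x =>
    congrArg (fun T => T x) (coresolventRoot_mul_self L hL)
  rw [← hP, ← hQ] at *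
  apply LinearPMap.eq_of_eq_graph
  ext ⟨x, z⟩
  change (x, z) ∈ (compOp _ (compOp _ (LinearMap.id.toPMap ⊤))).graph ↔ _
  have hid : ∀ u v : H, (u, v) ∈ ((LinearMap.id : H →ₗ[ℂ] H).toPMap ⊤).graph ↔ u = v := by
    intro u v
    rw [LinearPMap.mem_graph_iff]
    constructor
    · rintro ⟨a, rfl, rfl⟩; rfl
    · rintro rfl; exact ⟨⟨u, Submodule.mem_top⟩, rfl, rfl⟩
  simp only [mem_graph_compOp, hid, exists_eq_left', hgr]
  constructor
  · rintro ⟨y, ⟨u, rfl, rfl⟩, v, hv, rfl⟩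
    have hu : u = P (P u + Q v) := by
      rw [map_add, hPQ, hv, hdec]
    set m := P u + Q v with hm
    have hv' : v = Q m := hinj (by rw [hv, hPQ, ← hu])
    obtain ⟨x, h1, h2⟩ := resolvent_spec L hL m
    rw [hu, hv', hPP, hQQ, ← h1]
    rw [LinearPMap.mem_graph_iff]
    exact ⟨x, rfl, by rw [eq_sub_iff_add_eq', h2]⟩
  · intro h
    obtain ⟨a, h1, h2⟩ := (LinearPMap.mem_graph_iff _).1 h
    simp only at h1 h2
    have h3 := resolvent_apply L hL a
    rw [h1, h2] at h3
    refine ⟨Q (P (x + z)), ⟨P (x + z), ?_, rfl⟩, Q (x + z), hPQ _, ?_⟩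
    · rw [hPP, h3]
    · rw [hQQ, h3]; abel


end Operators

section Interpolation

variable {E : Type*} [AddCommGroup E]

/-- Peetre's functional `K(f, t)` of two spaces contained in `E`, whose norms
`N₀`, `N₁` take the value `∞` outside of the respective space: the infimum of `N₀ f₀ + t N₁ f₁`
over all the decompositions `f = f₀ + f₁`. -/
noncomputable def kFunctional (N₀ N₁ : E → ℝ≥0∞) (f : E) (t : ℝ) : ℝ≥0∞ :=
  ⨅ (f₀ : E) (f₁ : E) (_ : f = f₀ + f₁), (N₀ f₀ + ENNReal.ofReal t * N₁ f₁)

/-- The norm of the real interpolation space `(N₀, N₁)^K_{θ, q}`, with the value `∞` for the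
elements which are not in this space. -/
noncomputable def interpolationENorm (N₀ N₁ : E → ℝ≥0∞) (θ : ℝ) (q : ℝ≥0∞) (f : E) : ℝ≥0∞ :=
  if q = ∞ then ⨆ t ∈ Set.Ioi (0 : ℝ), ENNReal.ofReal (t ^ (-θ)) * kFunctional N₀ N₁ f t
  else (∫⁻ t in Set.Ioi (0 : ℝ),
    (ENNReal.ofReal (t ^ (-θ)) * kFunctional N₀ N₁ f t) ^ q.toReal * ENNReal.ofReal t⁻¹)
      ^ q.toReal⁻¹

end Interpolation

section Besov

variable {H : Type*} [NormedAddCommGroup H] [InnerProductSpace ℂ H] [CompleteSpace H]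

/-- The norm of the Besov space `B^α_{H, q}(√L) = (H, H ^ r)^K_{α / r, q}`, where `H ^ r` is
the domain of `L ^ (r / 2)`. -/
noncomputable def besovENorm (L : H →ₗ.[ℂ] H) (hL : IsNonnegSelfAdjoint L) (r : ℕ) (α : ℝ)
    (q : ℝ≥0∞) (f : H) : ℝ≥0∞ :=
  interpolationENorm (fun f₀ => ‖f₀‖ₑ) (graphENorm (sqrtOp L hL) r) (α / r) q f

/-- The Besov space `B^α_{H, q}(√L) = (H, H ^ r)^K_{α / r, q}`. -/
def besovSpace (L : H →ₗ.[ℂ] H) (hL : IsNonnegSelfAdjoint L) (r : ℕ) (α : ℝ) (q : ℝ≥0∞) : Set H :=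
  {f | besovENorm L hL r α q f < ∞}

/-- A smooth non-increasing function `g` on `[0, ∞)`, equal to `1` on `[0, 1]` and supported in
`[0, 2]`. -/
structure IsDyadicCutoff (g : ℝ → ℝ) : Prop where
  contDiffOn : ContDiffOn ℝ (⊤ : ℕ∞) g (Set.Ici 0)
  antitoneOn : AntitoneOn g (Set.Ici 0)
  eq_one : ∀ l ∈ Set.Icc (0 : ℝ) 1, g l = 1
  eq_zero : ∀ l, 2 < l → g l = 0

/-- The quadratic dyadic partition of unity generated by `g`:
`F₀ = √g` and `F_j(l) = √(h(2^{-j} l))` for `j ≥ 1`, where `h(l) = g(l) - g(2 l)`. -/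
noncomputable def quadPartition (g : ℝ → ℝ) (j : ℕ) (l : ℝ) : ℝ :=
  if j = 0 then √(g l) else √(g ((2 ^ j)⁻¹ * l) - g (2 * ((2 ^ j)⁻¹ * l)))

theorem continuousOn_quadPartition {g : ℝ → ℝ} (hg : IsDyadicCutoff g) (j : ℕ) :
    ContinuousOn (fun l => quadPartition g j (√l)) (Set.Ici 0) := by
  have h1 : ∀ c : ℝ, 0 ≤ c → ContinuousOn (fun l => g (c * √l)) (Set.Ici 0) := fun c hc =>
    hg.contDiffOn.continuousOn.comp (by fun_prop)
      fun l _ => mul_nonneg hc (Real.sqrt_nonneg l)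
  by_cases hj : j = 0
  · simpa [quadPartition, hj] using (h1 1 zero_le_one).sqrt
  · have h2 := ((h1 (2 ^ j)⁻¹ (by positivity)).sub
      (h1 (2 * (2 ^ j)⁻¹) (by positivity))).sqrt
    simpa [quadPartition, hj, mul_assoc] using h2

theorem tendsto_quadPartition {g : ℝ → ℝ} (hg : IsDyadicCutoff g) (j : ℕ) :
    Filter.Tendsto (fun l => quadPartition g j (√l)) Filter.atTop (nhds 0) := by
  have h1 : ∀ c : ℝ, 0 < c → ∀ᶠ l in Filter.atTop, g (c * √l) = 0 := fun c hc =>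
    ((Real.tendsto_sqrt_atTop.const_mul_atTop hc).eventually_gt_atTop 2).mono fun l hl =>
      hg.eq_zero _ hl
  refine Filter.Tendsto.congr' ?_ tendsto_const_nhds
  filter_upwards [h1 1 one_pos, h1 (2 ^ j)⁻¹ (by positivity), h1 (2 * (2 ^ j)⁻¹) (by positivity)]
    with l h2 h3 h4
  rw [one_mul] at h2
  rw [mul_assoc] at h4
  simp [quadPartition, h2, h3, h4]

/-- The bounded operator `F_j(√L)`. -/
noncomputable def labelProjection (L : H →ₗ.[ℂ] H) (hL : IsNonnegSelfAdjoint L) (g : ℝ → ℝ)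
    (j : ℕ) : H →L[ℂ] H :=
  funcCalc L hL (fun l => quadPartition g j (√l))

/-- The norm `(∑_j (2^{jα} ‖F_j(√L) f‖)^q)^{1/q}`, with the supremum over `j` for `q = ∞`. -/
noncomputable def dyadicENorm (L : H →ₗ.[ℂ] H) (hL : IsNonnegSelfAdjoint L) (g : ℝ → ℝ) (α : ℝ)
    (q : ℝ≥0∞) (f : H) : ℝ≥0∞ :=
  if q = ∞ then ⨆ j : ℕ, ENNReal.ofReal (2 ^ (j * α)) * ‖labelProjection L hL g j f‖ₑ
  else (∑' j : ℕ, (ENNReal.ofReal (2 ^ (j * α)) * ‖labelProjection L hL g j f‖ₑ) ^ q.toReal)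
      ^ q.toReal⁻¹

end Besov

end SpectralBesov

open SpectralBesov

/-!
The equivalence of the two norms is Peetre's interpolation argument, with the `K`-functional
sampled at the scales `2 ^ (-n r)`.

The powers of `t` and the monotonicity of `K(f, ·)` make the interpolation norm equivalent to the
`ℓ^q` norm of the samples `2 ^ (n α) K(f, 2 ^ (-n r))`, `n ∈ ℤ` (`interpolationENorm_le_kSample`,
`kSample_le_interpolationENorm`). It remains to compare these samples with the weighted norms
`2 ^ (j α) ‖F_j(√L) f‖`.

Since `F_j` vanishes above `2 ^ (j + 1)` and, for `j ≥ 1`, below `2 ^ (j - 1)`, the operator `F_j(√L)`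
satisfies a Jackson inequality, `‖F_j(√L) f₁‖ ≤ 2 ^ (-(j - 1) r) ‖L ^ (r / 2) f₁‖` for `j ≥ 1`,
and a Bernstein inequality, `‖L ^ (r / 2) F_j(√L) y‖ ≤ 2 ^ ((j + 1) r) ‖y‖`. In the functional
calculus of `(1 + L)⁻¹` both are pointwise bounds between `√s` and `√(1 - s)`, because
the graph of `(√L) ^ k` contains the pairs `(P ^ k h, Q ^ k h)` and all its elements `(x, z)` satisfy
`Q ^ k x = P ^ k z`, where `P = (1 + L) ^ (-1/2)` and `Q = (L (1 + L)⁻¹) ^ (1/2)`.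

Applied to an arbitrary decomposition of `f`, Jackson's inequality bounds `‖F_n(√L) f‖` by
`K(f, 2 ^ (-n r))` (`enorm_labelProjection_le_kFunctional`). Conversely, the reproducing formula
`f = ∑ F_j(√L) F_j(√L) f` is cut at `j = n`, and Bernstein's inequality for the first part bounds
`K(f, 2 ^ (-n r))` by `∑ min(1, 2 ^ ((j - n) r)) ‖F_j(√L) f‖` (`kFunctional_le_tsum`). With
the weights `2 ^ (n α)` this kernel decays geometrically in `|n - j|`, as `0 < α < r`, and Schur's
test (`lqENorm_tsum_mul_le`) shows that it is bounded on `ℓ^q`.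
-/

namespace SpectralBesov

/-! ### Weighted sums in `ℓ^q` -/

section Sequences

open MeasureTheory

variable {ι κ : Type*}

/-- The `ℓ^q` norm of an extended non-negative family, with the supremum for `q = ∞`. -/
noncomputable def lqENorm (q : ℝ≥0∞) (a : ι → ℝ≥0∞) : ℝ≥0∞ :=
  if q = ∞ then ⨆ i, a i else (∑' i, a i ^ q.toReal) ^ q.toReal⁻¹

theorem one_le_toReal {q : ℝ≥0∞} (hq : 1 ≤ q) (hq' : q ≠ ∞) : 1 ≤ q.toReal := by
  simpa using ENNReal.toReal_mono hq' hq

theorem lqENorm_mono {q : ℝ≥0∞} {a b : ι → ℝ≥0∞} (h : ∀ i, a i ≤ b i) :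
    lqENorm q a ≤ lqENorm q b := by
  unfold lqENorm
  split_ifs
  · exact iSup_mono h
  · gcongr with i
    exact h i

theorem lqENorm_const_mul {q : ℝ≥0∞} (hq : 1 ≤ q) (c : ℝ≥0∞) (a : ι → ℝ≥0∞) :
    lqENorm q (fun i => c * a i) = c * lqENorm q a := by
  unfold lqENorm
  split_ifs with h
  · rw [ENNReal.mul_iSup]
  · have hq0 := zero_lt_one.trans_le (one_le_toReal hq h)
    simp_rw [ENNReal.mul_rpow_of_nonneg _ _ hq0.le]
    rw [ENNReal.tsum_mul_left, ENNReal.mul_rpow_of_nonneg _ _ (inv_nonneg.2 hq0.le),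
      ENNReal.rpow_rpow_inv hq0.ne']

theorem lqENorm_comp_le_of_injective {q : ℝ≥0∞} {e : κ → ι} (he : Function.Injective e)
    (a : ι → ℝ≥0∞) : lqENorm q (fun k => a (e k)) ≤ lqENorm q a := by
  unfold lqENorm
  split_ifs
  · exact iSup_comp_le a e
  · gcongr
    exact ENNReal.tsum_comp_le_tsum_of_injective he (fun i => a i ^ q.toReal)

/-- Jensen's inequality for the power `p ≥ 1` and a weight `w` of finite mass. -/
theorem tsum_mul_rpow_le [Countable ι] (w a : ι → ℝ≥0∞) {p : ℝ} (hp : 1 ≤ p) :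
    (∑' i, w i * a i) ^ p ≤ (∑' i, w i) ^ (p - 1) * ∑' i, w i * a i ^ p := by
  let _ : MeasurableSpace ι := ⊤
  have hp0 : 0 < p := zero_lt_one.trans_le hp
  set μ : Measure ι := Measure.count.withDensity w with hμ
  have hint : ∀ u : ι → ℝ≥0∞, ∫⁻ i, u i ∂μ = ∑' i, w i * u i := fun u => by
    rw [hμ, lintegral_withDensity_eq_lintegral_mul _ (measurable_from_top)
      (measurable_from_top), lintegral_count]
    rfl
  have huniv : μ Set.univ = ∑' i, w i := by
    rw [← setLIntegral_one, Measure.restrict_univ, hint]; simp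
  have h := eLpNorm'_le_eLpNorm'_mul_rpow_measure_univ (μ := μ) (f := a) one_pos hp
    measurable_from_top.aestronglyMeasurable
  simp only [eLpNorm', enorm_eq_self, ENNReal.rpow_one, div_one, huniv, hint] at h
  refine (ENNReal.rpow_le_rpow h hp0.le).trans_eq ?_
  rw [ENNReal.mul_rpow_of_nonneg _ _ hp0.le, one_div, ENNReal.rpow_inv_rpow hp0.ne',
    ← ENNReal.rpow_mul, mul_comm, sub_mul, inv_mul_cancel₀ hp0.ne', one_mul]

/-- Schur's test: a kernel whose rows and columns have mass at most `W` is bounded by `W`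
on `ℓ^q`. -/
theorem lqENorm_tsum_mul_le [Countable κ] {q : ℝ≥0∞} (hq : 1 ≤ q) {w : ι → κ → ℝ≥0∞} {W : ℝ≥0∞}
    (hrow : ∀ i, ∑' k, w i k ≤ W) (hcol : ∀ k, ∑' i, w i k ≤ W) (a : κ → ℝ≥0∞) :
    lqENorm q (fun i => ∑' k, w i k * a k) ≤ W * lqENorm q a := by
  unfold lqENorm
  split_ifs with h
  · refine iSup_le fun i => ?_
    calc ∑' k, w i k * a k ≤ ∑' k, w i k * ⨆ k, a k := by
          gcongr with k
          exact le_iSup a k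
      _ ≤ W * ⨆ k, a k := by
          rw [ENNReal.tsum_mul_right]
          gcongr
          exact hrow i
  · set p := q.toReal
    have hp : 1 ≤ p := one_le_toReal hq h
    have hp0 : 0 < p := zero_lt_one.trans_le hp
    have key : ∑' i, (∑' k, w i k * a k) ^ p ≤ W ^ p * ∑' k, a k ^ p := by
      calc ∑' i, (∑' k, w i k * a k) ^ p
          ≤ ∑' i, W ^ (p - 1) * ∑' k, w i k * a k ^ p := by
            refine ENNReal.tsum_le_tsum fun i => (tsum_mul_rpow_le _ _ hp).trans ?_
            gcongr
            exact hrow i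
        _ = W ^ (p - 1) * ∑' k, (∑' i, w i k) * a k ^ p := by
            rw [ENNReal.tsum_mul_left, ENNReal.tsum_comm]
            simp_rw [ENNReal.tsum_mul_right]
        _ ≤ W ^ (p - 1) * ∑' k, W * a k ^ p := by
            gcongr with k
            exact hcol k
        _ = W ^ p * ∑' k, a k ^ p := by
            rw [ENNReal.tsum_mul_left, ← mul_assoc]
            congr 1
            nth_rewrite 2 [← ENNReal.rpow_one W]
            rw [← ENNReal.rpow_add_of_nonneg _ _ (sub_nonneg.2 hp) zero_le_one, sub_add_cancel]
    calc (∑' i, (∑' k, w i k * a k) ^ p) ^ p⁻¹ ≤ (W ^ p * ∑' k, a k ^ p) ^ p⁻¹ := by gcongr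
      _ = W * (∑' k, a k ^ p) ^ p⁻¹ := by
        rw [ENNReal.mul_rpow_of_nonneg _ _ (inv_nonneg.2 hp0.le), ENNReal.rpow_rpow_inv hp0.ne']

theorem tsum_pow_natAbs_lt_top {x : ℝ≥0∞} (hx : x < 1) : ∑' m : ℤ, x ^ m.natAbs < ∞ := by
  have hg : ∑' n : ℕ, x ^ n < ∞ := by
    rw [ENNReal.tsum_geometric]
    simpa using hx
  rw [tsum_of_nat_of_neg_add_one ENNReal.summable ENNReal.summable]
  refine ENNReal.add_lt_top.2 ⟨by simpa using hg, lt_of_le_of_lt ?_ hg⟩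
  refine ENNReal.tsum_le_tsum fun n => ?_
  have : (-((n : ℤ) + 1)).natAbs = n + 1 := by omega
  rw [this, pow_succ]
  exact mul_le_of_le_one_right' hx.le

end Sequences

/-! ### Discretization of the real interpolation norm -/

section Discretization

open MeasureTheory

variable {E : Type*} [AddCommGroup E]

theorem kFunctional_mono (N₀ N₁ : E → ℝ≥0∞) (f : E) : Monotone (kFunctional N₀ N₁ f) := by
  intro s t hst
  unfold kFunctional
  gcongr

/-- The samples of `t ↦ t ^ (-θ) K(f, t)` along the geometric progression `b ^ m`, `m ∈ ℤ`. -/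
noncomputable def kSample (N₀ N₁ : E → ℝ≥0∞) (θ b : ℝ) (f : E) (m : ℤ) : ℝ≥0∞ :=
  ENNReal.ofReal ((b ^ m) ^ (-θ)) * kFunctional N₀ N₁ f (b ^ m)

variable {b θ : ℝ}

theorem iUnion_Ioc_zpow (hb : 1 < b) :
    ⋃ m : ℤ, Set.Ioc (b ^ m) (b ^ (m + 1)) = Set.Ioi 0 := by
  ext t
  simp only [Set.mem_iUnion, Set.mem_Ioi]
  refine ⟨fun ⟨m, hm⟩ => (zpow_pos (by positivity) m).trans hm.1, fun ht => ?_⟩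
  exact exists_mem_Ioc_zpow ht hb

theorem pairwise_disjoint_Ioc_zpow (hb : 1 < b) :
    Pairwise (Function.onFun Disjoint fun m : ℤ => Set.Ioc (b ^ m) (b ^ (m + 1))) :=
  (zpow_right_strictMono₀ hb).monotone.pairwise_disjoint_on_Ioc_succ

theorem volume_Ioc_zpow (hb : 1 < b) (m : ℤ) :
    volume (Set.Ioc (b ^ m) (b ^ (m + 1))) = ENNReal.ofReal (b ^ m * (b - 1)) := by
  rw [Real.volume_Ioc, zpow_add_one₀ (by positivity)]
  congr 1
  ring

theorem integrand_le_kSample (hb : 1 < b) (hθ : 0 < θ) (N₀ N₁ : E → ℝ≥0∞) (f : E) {m : ℤ} {t : ℝ}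
    (ht : t ∈ Set.Ioc (b ^ m) (b ^ (m + 1))) :
    ENNReal.ofReal (t ^ (-θ)) * kFunctional N₀ N₁ f t ≤
      ENNReal.ofReal (b ^ θ) * kSample N₀ N₁ θ b f (m + 1) := by
  have hb0 : 0 < b := zero_lt_one.trans hb
  have hm : 0 < b ^ m := zpow_pos hb0 m
  have h1 : t ^ (-θ) ≤ b ^ θ * (b ^ (m + 1)) ^ (-θ) := by
    calc t ^ (-θ) ≤ (b ^ m) ^ (-θ) :=
          Real.rpow_le_rpow_of_nonpos hm ht.1.le (neg_nonpos.2 hθ.le)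
      _ = b ^ θ * (b ^ (m + 1)) ^ (-θ) := by
          rw [zpow_add_one₀ hb0.ne', Real.mul_rpow hm.le hb0.le, mul_left_comm,
            ← Real.rpow_add hb0, add_neg_cancel, Real.rpow_zero, mul_one]
  rw [kSample, ← mul_assoc, ← ENNReal.ofReal_mul (by positivity)]
  gcongr
  exact kFunctional_mono N₀ N₁ f ht.2

theorem kSample_le_integrand (hb : 1 < b) (hθ : 0 < θ) (N₀ N₁ : E → ℝ≥0∞) (f : E) {m : ℤ} {t : ℝ}
    (ht : t ∈ Set.Ioc (b ^ m) (b ^ (m + 1))) :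
    kSample N₀ N₁ θ b f m ≤
      ENNReal.ofReal (b ^ θ) * (ENNReal.ofReal (t ^ (-θ)) * kFunctional N₀ N₁ f t) := by
  have hb0 : 0 < b := zero_lt_one.trans hb
  have hm : 0 < b ^ m := zpow_pos hb0 m
  have ht0 : 0 < t := hm.trans ht.1
  have h1 : (b ^ m) ^ (-θ) ≤ b ^ θ * t ^ (-θ) := by
    calc (b ^ m) ^ (-θ) = b ^ θ * (b ^ (m + 1)) ^ (-θ) := by
          rw [zpow_add_one₀ hb0.ne', Real.mul_rpow hm.le hb0.le, mul_left_comm,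
            ← Real.rpow_add hb0, add_neg_cancel, Real.rpow_zero, mul_one]
      _ ≤ b ^ θ * t ^ (-θ) := by
          gcongr ?_ * ?_
          exact Real.rpow_le_rpow_of_nonpos ht0 ht.2 (neg_nonpos.2 hθ.le)
  rw [kSample, ← mul_assoc, ← ENNReal.ofReal_mul (by positivity)]
  gcongr
  exact kFunctional_mono N₀ N₁ f ht.1.le

/-- The interpolation norm is controlled by the samples of the `K`-functional. -/
theorem interpolationENorm_le_kSample (hb : 1 < b) (hθ : 0 < θ) {q : ℝ≥0∞} (hq : 1 ≤ q)
    (N₀ N₁ : E → ℝ≥0∞) :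
    ∃ C : ℝ≥0∞, C ≠ ∞ ∧ ∀ f,
      interpolationENorm N₀ N₁ θ q f ≤ C * lqENorm q (kSample N₀ N₁ θ b f) := by
  have hb0 : 0 < b := zero_lt_one.trans hb
  unfold interpolationENorm lqENorm
  split_ifs with h
  · refine ⟨ENNReal.ofReal (b ^ θ), ENNReal.ofReal_ne_top, fun f => iSup₂_le fun t ht => ?_⟩
    obtain ⟨m, hm⟩ := exists_mem_Ioc_zpow ht hb
    refine (integrand_le_kSample hb hθ N₀ N₁ f hm).trans ?_
    gcongr
    exact le_iSup (kSample N₀ N₁ θ b f) (m + 1)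
  · set p := q.toReal
    have hp0 : 0 < p := zero_lt_one.trans_le (one_le_toReal hq h)
    set B := ENNReal.ofReal (b ^ θ)
    refine ⟨(B ^ p * ENNReal.ofReal (b - 1)) ^ p⁻¹, ?_, fun f => ?_⟩
    · finiteness
    rw [← ENNReal.mul_rpow_of_nonneg _ _ (inv_nonneg.2 hp0.le)]
    gcongr
    rw [← iUnion_Ioc_zpow hb]
    refine (lintegral_iUnion_le _ _).trans ?_
    rw [← (Equiv.addRight (1 : ℤ)).tsum_eq (fun m => kSample N₀ N₁ θ b f m ^ p),
      ← ENNReal.tsum_mul_left]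
    refine ENNReal.tsum_le_tsum fun m => ?_
    have hm : 0 < b ^ m := zpow_pos hb0 m
    calc ∫⁻ t in Set.Ioc (b ^ m) (b ^ (m + 1)),
          (ENNReal.ofReal (t ^ (-θ)) * kFunctional N₀ N₁ f t) ^ p * ENNReal.ofReal t⁻¹
        ≤ ∫⁻ _ in Set.Ioc (b ^ m) (b ^ (m + 1)),
          (B * kSample N₀ N₁ θ b f (m + 1)) ^ p * ENNReal.ofReal (b ^ m)⁻¹ := by
          refine setLIntegral_mono' measurableSet_Ioc fun t ht => ?_
          exact mul_le_mul'
            (ENNReal.rpow_le_rpow (integrand_le_kSample hb hθ N₀ N₁ f ht) hp0.le)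
            (ENNReal.ofReal_le_ofReal (inv_anti₀ hm ht.1.le))
      _ = B ^ p * ENNReal.ofReal (b - 1) * kSample N₀ N₁ θ b f (m + 1) ^ p := by
          rw [setLIntegral_const, volume_Ioc_zpow hb, mul_assoc,
            ← ENNReal.ofReal_mul (by positivity), inv_mul_cancel_left₀ hm.ne',
            ENNReal.mul_rpow_of_nonneg _ _ hp0.le]
          ring

/-- The samples of the `K`-functional are controlled by the interpolation norm. -/
theorem kSample_le_interpolationENorm (hb : 1 < b) (hθ : 0 < θ) {q : ℝ≥0∞} (hq : 1 ≤ q)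
    (N₀ N₁ : E → ℝ≥0∞) :
    ∃ C : ℝ≥0∞, C ≠ ∞ ∧ ∀ f,
      lqENorm q (kSample N₀ N₁ θ b f) ≤ C * interpolationENorm N₀ N₁ θ q f := by
  have hb0 : 0 < b := zero_lt_one.trans hb
  unfold interpolationENorm lqENorm
  split_ifs with h
  · refine ⟨ENNReal.ofReal (b ^ θ), ENNReal.ofReal_ne_top, fun f => iSup_le fun m => ?_⟩
    have hm : b ^ (m + 1) ∈ Set.Ioc (b ^ m) (b ^ (m + 1)) :=
      ⟨zpow_lt_zpow_right₀ hb (lt_add_one m), le_rfl⟩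
    refine (kSample_le_integrand hb hθ N₀ N₁ f hm).trans ?_
    gcongr
    exact le_iSup₂ (f := fun (t : ℝ) (_ : t ∈ Set.Ioi (0 : ℝ)) =>
      ENNReal.ofReal (t ^ (-θ)) * kFunctional N₀ N₁ f t) _ (zpow_pos hb0 (m + 1))
  · set p := q.toReal
    have hp0 : 0 < p := zero_lt_one.trans_le (one_le_toReal hq h)
    set B := ENNReal.ofReal (b ^ θ)
    refine ⟨(B ^ p * ENNReal.ofReal (b / (b - 1))) ^ p⁻¹, ?_, fun f => ?_⟩
    · finiteness
    rw [← ENNReal.mul_rpow_of_nonneg _ _ (inv_nonneg.2 hp0.le)]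
    gcongr
    rw [← iUnion_Ioc_zpow hb, lintegral_iUnion (fun _ => measurableSet_Ioc)
      (pairwise_disjoint_Ioc_zpow hb), ← ENNReal.tsum_mul_left]
    refine ENNReal.tsum_le_tsum fun m => ?_
    have hm : 0 < b ^ m := zpow_pos hb0 m
    have hmass : 1 = ENNReal.ofReal (b / (b - 1)) *
        (ENNReal.ofReal (b ^ (m + 1))⁻¹ * ENNReal.ofReal (b ^ m * (b - 1))) := by
      have : 0 < b - 1 := sub_pos.2 hb
      rw [← ENNReal.ofReal_mul (by positivity), ← ENNReal.ofReal_mul (by positivity),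
        zpow_add_one₀ hb0.ne', ← ENNReal.ofReal_one]
      congr 1
      field_simp
    calc kSample N₀ N₁ θ b f m ^ p
        = ENNReal.ofReal (b / (b - 1)) * ∫⁻ _ in Set.Ioc (b ^ m) (b ^ (m + 1)),
            kSample N₀ N₁ θ b f m ^ p * ENNReal.ofReal (b ^ (m + 1))⁻¹ := by
          rw [setLIntegral_const, volume_Ioc_zpow hb, mul_assoc, mul_left_comm, ← hmass, mul_one]
      _ ≤ ENNReal.ofReal (b / (b - 1)) * ∫⁻ t in Set.Ioc (b ^ m) (b ^ (m + 1)),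
            B ^ p * ((ENNReal.ofReal (t ^ (-θ)) * kFunctional N₀ N₁ f t) ^ p *
              ENNReal.ofReal t⁻¹) := by
          refine mul_le_mul' le_rfl (setLIntegral_mono' measurableSet_Ioc fun t ht => ?_)
          rw [← mul_assoc, ← ENNReal.mul_rpow_of_nonneg _ _ hp0.le]
          have ht0 : 0 < t := hm.trans ht.1
          exact mul_le_mul'
            (ENNReal.rpow_le_rpow (kSample_le_integrand hb hθ N₀ N₁ f ht) hp0.le)
            (ENNReal.ofReal_le_ofReal (inv_anti₀ ht0 ht.2))
      _ = _ := by
          rw [lintegral_const_mul' _ _ (by finiteness), ← mul_assoc, mul_comm (B ^ p)]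

end Discretization

/-! ### Powers of the square root -/

section Powers

section Graph

variable {H : Type*} [NormedAddCommGroup H] [InnerProductSpace ℂ H]

theorem mem_graph_powOp_zero (S : H →ₗ.[ℂ] H) (x y : H) :
    (x, y) ∈ (powOp S 0).graph ↔ x = y := by
  change (x, y) ∈ ((LinearMap.id : H →ₗ[ℂ] H).toPMap ⊤).graph ↔ _
  rw [LinearPMap.mem_graph_iff]
  constructor
  · rintro ⟨a, rfl, rfl⟩; rfl
  · rintro rfl; exact ⟨⟨x, Submodule.mem_top⟩, rfl, rfl⟩

theorem graphENorm_le_of_mem_graph {S : H →ₗ.[ℂ] H} {k : ℕ} {x z : H}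
    (h : (x, z) ∈ (powOp S k).graph) : graphENorm S k x ≤ ‖x‖ₑ + ‖z‖ₑ := by
  obtain ⟨u, rfl, rfl⟩ := (LinearPMap.mem_graph_iff _).1 h
  exact iInf_le _ u.2

end Graph

variable {H : Type*} [NormedAddCommGroup H] [InnerProductSpace ℂ H] [CompleteSpace H]
  (L : H →ₗ.[ℂ] H) (hL : IsNonnegSelfAdjoint L)

theorem pow_mem_graph_powOp (k : ℕ) (h : H) :
    ((resolventRoot L hL ^ k) h, (coresolventRoot L hL ^ k) h) ∈
      (powOp (sqrtOp L hL) k).graph := by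
  induction k generalizing h with
  | zero => exact (mem_graph_powOp_zero _ _ _).2 rfl
  | succ k ih =>
    refine (mem_graph_compOp _ _ _ _).2
      ⟨(coresolventRoot L hL ^ k) (resolventRoot L hL h), ?_, ?_⟩
    · rw [pow_succ, mul_apply_eq_comp]
      exact ih _
    · refine (mem_graph_sqrtOp L hL _ _).2 ⟨(coresolventRoot L hL ^ k) h, ?_, ?_⟩
      · rw [← mul_apply_eq_comp, ← mul_apply_eq_comp]
        exact congrArg (fun T => T h)
          ((show Commute _ _ from resolventRoot_comm L hL).pow_right k)
      · rw [pow_succ', mul_apply_eq_comp]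

theorem coresolventRoot_pow_of_mem_graph {k : ℕ} {x z : H}
    (h : (x, z) ∈ (powOp (sqrtOp L hL) k).graph) :
    (coresolventRoot L hL ^ k) x = (resolventRoot L hL ^ k) z := by
  induction k generalizing z with
  | zero => exact (mem_graph_powOp_zero _ _ _).1 h
  | succ k ih =>
    obtain ⟨y, hxy, hyz⟩ := (mem_graph_compOp _ _ _ _).1 h
    obtain ⟨u, rfl, rfl⟩ := (mem_graph_sqrtOp L hL _ _).1 hyz
    have hcomm : Commute (resolventRoot L hL) (coresolventRoot L hL) := resolventRoot_comm L hL
    have h1 := (hcomm.pow_left (k + 1)).eq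
    rw [pow_succ', mul_apply_eq_comp, ih hxy,
      ← mul_apply_eq_comp (resolventRoot L hL ^ (k + 1)), h1, pow_succ]
    rfl

end Powers

/-! ### Spectral localization -/

section Localization

variable {H : Type*} [NormedAddCommGroup H] [InnerProductSpace ℂ H] [CompleteSpace H]
  (L : H →ₗ.[ℂ] H) (hL : IsNonnegSelfAdjoint L)

theorem norm_cfc_resolvent_apply_le {φ : ℝ → ℝ} {c : ℝ} (hc : 0 ≤ c)
    (h : ∀ s ∈ Set.Icc (0 : ℝ) 1, |φ s| ≤ c) (x : H) :
    ‖cfc φ (resolvent L hL) x‖ ≤ c * ‖x‖ :=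
  (ContinuousLinearMap.le_opNorm _ x).trans <| by
    gcongr
    exact norm_cfc_le hc fun s hs => h s (resolvent_spectrum L hL hs)

theorem resolventRoot_pow (k : ℕ) :
    resolventRoot L hL ^ k = cfc (fun s : ℝ => √s ^ k) (resolvent L hL) := by
  have := resolvent_isSelfAdjoint L hL
  rw [resolventRoot, cfc_pow _ _ _ (by fun_prop)]

theorem coresolventRoot_pow (k : ℕ) :
    coresolventRoot L hL ^ k = cfc (fun s : ℝ => √(1 - s) ^ k) (resolvent L hL) := by
  have := resolvent_isSelfAdjoint L hL
  rw [coresolventRoot, cfc_pow _ _ _ (by fun_prop)]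

/-- Bernstein's inequality: a spectral multiplier supported in `{√L ≤ M}` maps into the domain
of `(√L) ^ k`, with a loss of at most `M ^ k`. In the variable `s = (1 + l)⁻¹`, the quotient
`√(1 - s) / √s` is `√l`. -/
theorem exists_mem_graph_powOp_cfc {φ : ℝ → ℝ} (hφ : ContinuousOn φ (Set.Icc 0 1))
    (hφ1 : ∀ s ∈ Set.Icc (0 : ℝ) 1, |φ s| ≤ 1) {ε M : ℝ} (hε : 0 < ε) (hM : 0 ≤ M)
    (h : ∀ s ∈ Set.Icc (0 : ℝ) 1, φ s ≠ 0 → ε ≤ √s ∧ √(1 - s) ≤ M * √s) (k : ℕ) (y : H) :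
    ∃ z, (cfc φ (resolvent L hL) y, z) ∈ (powOp (sqrtOp L hL) k).graph ∧ ‖z‖ ≤ M ^ k * ‖y‖ := by
  have hsub := resolvent_spectrum L hL
  -- On the support of `φ` the denominator is `√s ^ k`; the maximum keeps it away from `0`.
  set ψ : ℝ → ℝ := fun s => φ s / max √s ε ^ k with hψ
  have hψc : ContinuousOn ψ (Set.Icc 0 1) := by
    refine hφ.div (by fun_prop) fun s _ => ?_
    have : 0 < max √s ε := lt_max_of_lt_right hε
    positivity
  have h1 : resolventRoot L hL ^ k * cfc ψ (resolvent L hL) = cfc φ (resolvent L hL) := by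
    rw [resolventRoot_pow, ← cfc_mul _ _ _ (by fun_prop) (hψc.mono hsub)]
    refine cfc_congr fun s hs => ?_
    by_cases h0 : φ s = 0
    · simp [hψ, h0]
    · obtain ⟨h2, -⟩ := h s (hsub hs) h0
      have : 0 < √s := hε.trans_le h2
      simp only [hψ, max_eq_left h2]
      field_simp
  refine ⟨(coresolventRoot L hL ^ k) (cfc ψ (resolvent L hL) y), ?_, ?_⟩
  · rw [← h1]
    exact pow_mem_graph_powOp L hL k _
  · rw [← mul_apply_eq_comp, coresolventRoot_pow,
      ← cfc_mul _ _ _ (by fun_prop) (hψc.mono hsub)]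
    refine norm_cfc_resolvent_apply_le L hL (by positivity) (fun s hs => ?_) y
    by_cases h0 : φ s = 0
    · simp only [hψ, h0, zero_div, mul_zero, abs_zero]
      positivity
    · obtain ⟨h2, h3⟩ := h s hs h0
      have hs0 : 0 < √s := hε.trans_le h2
      simp only [hψ, max_eq_left h2]
      rw [abs_mul, abs_div, abs_of_nonneg (by positivity : 0 ≤ √(1 - s) ^ k),
        abs_of_pos (by positivity : 0 < √s ^ k), ← mul_div_assoc, div_le_iff₀ (by positivity),
        ← mul_pow]
      exact (mul_le_of_le_one_right (by positivity) (hφ1 s hs)).trans (by gcongr)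

/-- Jackson's inequality: a spectral multiplier supported in `{√L ≥ M⁻¹}` gains `M ^ k` on the
domain of `(√L) ^ k`. -/
theorem norm_cfc_apply_le_of_mem_graph {φ : ℝ → ℝ} (hφ : ContinuousOn φ (Set.Icc 0 1))
    (hφ1 : ∀ s ∈ Set.Icc (0 : ℝ) 1, |φ s| ≤ 1) {ε M : ℝ} (hε : 0 < ε) (hM : 0 ≤ M)
    (h : ∀ s ∈ Set.Icc (0 : ℝ) 1, φ s ≠ 0 → ε ≤ √(1 - s) ∧ √s ≤ M * √(1 - s)) {k : ℕ} {x z : H}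
    (hxz : (x, z) ∈ (powOp (sqrtOp L hL) k).graph) :
    ‖cfc φ (resolvent L hL) x‖ ≤ M ^ k * ‖z‖ := by
  have hsub := resolvent_spectrum L hL
  set ψ : ℝ → ℝ := fun s => φ s / max √(1 - s) ε ^ k with hψ
  have hψc : ContinuousOn ψ (Set.Icc 0 1) := by
    refine hφ.div (by fun_prop) fun s _ => ?_
    have : 0 < max √(1 - s) ε := lt_max_of_lt_right hε
    positivity
  have h1 : cfc ψ (resolvent L hL) * coresolventRoot L hL ^ k = cfc φ (resolvent L hL) := by
    rw [coresolventRoot_pow, ← cfc_mul _ _ _ (hψc.mono hsub) (by fun_prop)]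
    refine cfc_congr fun s hs => ?_
    by_cases h0 : φ s = 0
    · simp [hψ, h0]
    · obtain ⟨h2, -⟩ := h s (hsub hs) h0
      have : 0 < √(1 - s) := hε.trans_le h2
      simp only [hψ, max_eq_left h2]
      field_simp
  rw [← h1, mul_apply_eq_comp, coresolventRoot_pow_of_mem_graph L hL hxz,
    ← mul_apply_eq_comp, resolventRoot_pow,
    ← cfc_mul _ _ _ (hψc.mono hsub) (by fun_prop)]
  refine norm_cfc_resolvent_apply_le L hL (by positivity) (fun s hs => ?_) z
  by_cases h0 : φ s = 0
  · simp only [hψ, h0, zero_div, zero_mul, abs_zero]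
    positivity
  · obtain ⟨h2, h3⟩ := h s hs h0
    have hs0 : 0 < √(1 - s) := hε.trans_le h2
    simp only [hψ, max_eq_left h2]
    rw [abs_mul, abs_div, abs_of_nonneg (by positivity : 0 ≤ √s ^ k),
      abs_of_pos (by positivity : 0 < √(1 - s) ^ k), div_mul_eq_mul_div,
      div_le_iff₀ (by positivity), ← mul_pow]
    exact (mul_le_of_le_one_left (by positivity) (hφ1 s hs)).trans (by gcongr)

theorem funcCalc_congr {F G : ℝ → ℝ} (h : ∀ l, 0 ≤ l → F l = G l) :
    funcCalc L hL F = funcCalc L hL G := by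
  refine cfc_congr fun s hs => ?_
  obtain ⟨h0, h1⟩ := resolvent_spectrum L hL hs
  rcases h0.eq_or_lt with rfl | h0
  · simp
  · simp only [if_neg h0.ne']
    exact h _ (sub_nonneg.2 ((one_le_inv₀ h0).2 h1))

theorem sqrt_one_sub_eq {s : ℝ} (hs : 0 < s) : √(1 - s) = √(s⁻¹ - 1) * √s := by
  rw [← Real.sqrt_mul' _ hs.le, sub_mul, inv_mul_cancel₀ hs.ne', one_mul]

theorem abs_changeOfVariable_le {F : ℝ → ℝ} (hF : ∀ l, 0 ≤ l → |F (√l)| ≤ 1) {s : ℝ}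
    (hs : s ∈ Set.Icc (0 : ℝ) 1) : |if s = 0 then 0 else F (√(s⁻¹ - 1))| ≤ 1 := by
  split_ifs with h
  · simp
  · exact hF _ (sub_nonneg.2 ((one_le_inv₀ (lt_of_le_of_ne hs.1 (Ne.symm h))).2 hs.2))

/-- Bernstein's inequality for the functional calculus of `√L`. -/
theorem exists_mem_graph_powOp_funcCalc {F : ℝ → ℝ}
    (hF : ContinuousOn (fun l => F (√l)) (Set.Ici 0))
    (hF0 : Filter.Tendsto (fun l => F (√l)) Filter.atTop (nhds 0))
    (hF1 : ∀ l, 0 ≤ l → |F (√l)| ≤ 1) {M : ℝ} (hM : 0 ≤ M)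
    (h : ∀ l, 0 ≤ l → F l ≠ 0 → l ≤ M) (k : ℕ) (y : H) :
    ∃ z, (funcCalc L hL (fun l => F (√l)) y, z) ∈ (powOp (sqrtOp L hL) k).graph ∧
      ‖z‖ ≤ M ^ k * ‖y‖ := by
  refine exists_mem_graph_powOp_cfc L hL (continuousOn_changeOfVariable hF hF0)
    (fun s hs => abs_changeOfVariable_le hF1 hs) (ε := √(1 / (1 + M ^ 2)))
    (Real.sqrt_pos.2 (by positivity)) hM (fun s hs hne => ?_) k y
  have hs0 : s ≠ 0 := fun h0 => hne (if_pos h0)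
  have hpos : 0 < s := lt_of_le_of_ne hs.1 hs0.symm
  rw [if_neg hs0] at hne
  have hl := h _ (Real.sqrt_nonneg _) hne
  have h1 : √(1 - s) ≤ M * √s := by
    rw [sqrt_one_sub_eq hpos]
    gcongr
  refine ⟨Real.sqrt_le_sqrt ?_, h1⟩
  have h2 := pow_le_pow_left₀ (Real.sqrt_nonneg _) h1 2
  rw [mul_pow, Real.sq_sqrt hs.1, Real.sq_sqrt (sub_nonneg.2 hs.2)] at h2
  rw [div_le_iff₀ (by positivity)]
  linarith

/-- Jackson's inequality for the functional calculus of `√L`. -/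
theorem norm_funcCalc_apply_le_of_mem_graph {F : ℝ → ℝ}
    (hF : ContinuousOn (fun l => F (√l)) (Set.Ici 0))
    (hF0 : Filter.Tendsto (fun l => F (√l)) Filter.atTop (nhds 0))
    (hF1 : ∀ l, 0 ≤ l → |F (√l)| ≤ 1) {m : ℝ} (hm : 0 < m)
    (h : ∀ l, 0 ≤ l → F l ≠ 0 → m ≤ l) {k : ℕ} {x z : H}
    (hxz : (x, z) ∈ (powOp (sqrtOp L hL) k).graph) :
    ‖funcCalc L hL (fun l => F (√l)) x‖ ≤ m⁻¹ ^ k * ‖z‖ := by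
  refine norm_cfc_apply_le_of_mem_graph L hL (continuousOn_changeOfVariable hF hF0)
    (fun s hs => abs_changeOfVariable_le hF1 hs) (ε := √(m ^ 2 / (1 + m ^ 2)))
    (Real.sqrt_pos.2 (by positivity)) (inv_nonneg.2 hm.le) (fun s hs hne => ?_) hxz
  have hs0 : s ≠ 0 := fun h0 => hne (if_pos h0)
  have hpos : 0 < s := lt_of_le_of_ne hs.1 hs0.symm
  rw [if_neg hs0] at hne
  have hl := h _ (Real.sqrt_nonneg _) hne
  have h1 : m * √s ≤ √(1 - s) := by
    rw [sqrt_one_sub_eq hpos]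
    gcongr
  refine ⟨Real.sqrt_le_sqrt ?_, (le_inv_mul_iff₀ hm).2 h1⟩
  have h2 := pow_le_pow_left₀ (by positivity) h1 2
  rw [mul_pow, Real.sq_sqrt hs.1, Real.sq_sqrt (sub_nonneg.2 hs.2)] at h2
  rw [div_le_iff₀ (by positivity)]
  linarith

end Localization

/-! ### The dyadic partition of unity -/

section Partition

variable {g : ℝ → ℝ}

theorem IsDyadicCutoff.nonneg (hg : IsDyadicCutoff g) {l : ℝ} (hl : 0 ≤ l) : 0 ≤ g l := by
  have h := hg.antitoneOn (Set.mem_Ici.2 hl) (Set.mem_Ici.2 (by positivity : 0 ≤ l + 3))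
    (by linarith)
  rwa [hg.eq_zero (l + 3) (by linarith)] at h

theorem IsDyadicCutoff.le_one (hg : IsDyadicCutoff g) {l : ℝ} (hl : 0 ≤ l) : g l ≤ 1 := by
  have h := hg.antitoneOn (Set.mem_Ici.2 le_rfl) (Set.mem_Ici.2 hl) hl
  rwa [hg.eq_one 0 (by simp)] at h

theorem quadPartition_zero_mul_self (hg : IsDyadicCutoff g) {l : ℝ} (hl : 0 ≤ l) :
    quadPartition g 0 l * quadPartition g 0 l = g l := by
  rw [quadPartition, if_pos rfl, Real.mul_self_sqrt (hg.nonneg hl)]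

theorem quadPartition_succ (g : ℝ → ℝ) (j : ℕ) (l : ℝ) :
    quadPartition g (j + 1) l = √(g ((2 ^ (j + 1))⁻¹ * l) - g ((2 ^ j)⁻¹ * l)) := by
  rw [quadPartition, if_neg (Nat.succ_ne_zero j)]
  have h : 2 * ((2 ^ (j + 1))⁻¹ * l) = (2 ^ j)⁻¹ * l := by
    rw [pow_succ]
    field_simp
  rw [h]

theorem quadPartition_succ_mul_self (hg : IsDyadicCutoff g) (j : ℕ) {l : ℝ} (hl : 0 ≤ l) :
    quadPartition g (j + 1) l * quadPartition g (j + 1) l + g ((2 ^ j)⁻¹ * l) =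
      g ((2 ^ (j + 1))⁻¹ * l) := by
  rw [quadPartition_succ, Real.mul_self_sqrt, sub_add_cancel]
  refine sub_nonneg.2 (hg.antitoneOn (Set.mem_Ici.2 (by positivity))
    (Set.mem_Ici.2 (by positivity)) ?_)
  gcongr
  · norm_num
  · exact j.le_succ

theorem abs_quadPartition_le (hg : IsDyadicCutoff g) (j : ℕ) {l : ℝ} (hl : 0 ≤ l) :
    |quadPartition g j l| ≤ 1 := by
  rw [← abs_one, ← sq_le_sq, sq, one_pow]
  cases j with
  | zero => exact (quadPartition_zero_mul_self hg hl).trans_le (hg.le_one hl)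
  | succ j =>
    have h1 := quadPartition_succ_mul_self hg j hl
    have h2 := hg.nonneg (l := (2 ^ j)⁻¹ * l) (by positivity)
    have h3 := hg.le_one (l := (2 ^ (j + 1))⁻¹ * l) (by positivity)
    linarith

theorem le_of_quadPartition_ne_zero (hg : IsDyadicCutoff g) (j : ℕ) {l : ℝ}
    (h : quadPartition g j l ≠ 0) : l ≤ 2 ^ (j + 1) := by
  contrapose! h
  have hz : ∀ i ≤ j, g ((2 ^ i)⁻¹ * l) = 0 := fun i hi => by
    refine hg.eq_zero _ ?_
    rw [lt_inv_mul_iff₀ (by positivity), ← pow_succ]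
    exact lt_of_le_of_lt (by gcongr; norm_num) h
  cases j with
  | zero =>
    have h0 : g l = 0 := by simpa using hz 0 le_rfl
    rw [quadPartition, if_pos rfl, h0, Real.sqrt_zero]
  | succ j => rw [quadPartition_succ, hz _ le_rfl, hz _ j.le_succ, sub_zero, Real.sqrt_zero]

theorem le_of_quadPartition_succ_ne_zero (hg : IsDyadicCutoff g) (j : ℕ) {l : ℝ} (hl : 0 ≤ l)
    (h : quadPartition g (j + 1) l ≠ 0) : 2 ^ j ≤ l := by
  contrapose! h
  have hz : ∀ i, j ≤ i → g ((2 ^ i)⁻¹ * l) = 1 := fun i hi => by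
    refine hg.eq_one _ ⟨by positivity, ?_⟩
    rw [inv_mul_le_iff₀ (by positivity), mul_one]
    exact h.le.trans (by gcongr; norm_num)
  rw [quadPartition_succ, hz _ le_rfl, hz _ j.le_succ, sub_self, Real.sqrt_zero]

end Partition

section Projections

variable {H : Type*} [NormedAddCommGroup H] [InnerProductSpace ℂ H] [CompleteSpace H]
  (L : H →ₗ.[ℂ] H) (hL : IsNonnegSelfAdjoint L) {g : ℝ → ℝ} (hg : IsDyadicCutoff g)

theorem continuousOn_dilation (hg : IsDyadicCutoff g) (n : ℕ) :
    ContinuousOn (fun l => g ((2 ^ n)⁻¹ * √l)) (Set.Ici 0) :=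
  hg.contDiffOn.continuousOn.comp (by fun_prop) fun l _ => Set.mem_Ici.2 (by positivity)

theorem tendsto_dilation (hg : IsDyadicCutoff g) (n : ℕ) :
    Filter.Tendsto (fun l => g ((2 ^ n)⁻¹ * √l)) Filter.atTop (nhds 0) := by
  refine Filter.Tendsto.congr' ?_ tendsto_const_nhds
  filter_upwards [(Real.tendsto_sqrt_atTop.const_mul_atTop
    (by positivity : (0 : ℝ) < (2 ^ n)⁻¹)).eventually_gt_atTop 2] with l hl
  exact (hg.eq_zero _ hl).symm

include hg

theorem labelProjection_norm_le (j : ℕ) (x : H) : ‖labelProjection L hL g j x‖ ≤ ‖x‖ := by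
  rw [← one_mul ‖x‖]
  exact norm_cfc_resolvent_apply_le L hL zero_le_one
    (fun s hs => abs_changeOfVariable_le (F := quadPartition g j)
      (fun l _ => abs_quadPartition_le hg j (Real.sqrt_nonneg l)) hs) x

theorem norm_labelProjection_succ_le (j : ℕ) {k : ℕ} {x z : H}
    (hxz : (x, z) ∈ (powOp (sqrtOp L hL) k).graph) :
    ‖labelProjection L hL g (j + 1) x‖ ≤ (2 ^ j)⁻¹ ^ k * ‖z‖ :=
  norm_funcCalc_apply_le_of_mem_graph L hL (continuousOn_quadPartition hg (j + 1))
    (tendsto_quadPartition hg (j + 1))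
    (fun l _ => abs_quadPartition_le hg (j + 1) (Real.sqrt_nonneg l)) (by positivity)
    (fun _ hl h => le_of_quadPartition_succ_ne_zero hg j hl h) hxz

theorem exists_mem_graph_powOp_labelProjection (j k : ℕ) (y : H) :
    ∃ z, (labelProjection L hL g j y, z) ∈ (powOp (sqrtOp L hL) k).graph ∧
      ‖z‖ ≤ (2 ^ (j + 1)) ^ k * ‖y‖ :=
  exists_mem_graph_powOp_funcCalc L hL (continuousOn_quadPartition hg j)
    (tendsto_quadPartition hg j) (fun l _ => abs_quadPartition_le hg j (Real.sqrt_nonneg l))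
    (by positivity) (fun _ _ h => le_of_quadPartition_ne_zero hg j h) k y

/-- The partial sums of `∑ F_j ^ 2 = 1` telescope to the dilated cut-off `g(2 ^ (-n) √L)`. -/
theorem sum_labelProjection_mul_self (n : ℕ) :
    ∑ j ∈ Finset.range (n + 1), labelProjection L hL g j * labelProjection L hL g j =
      funcCalc L hL (fun l => g ((2 ^ n)⁻¹ * √l)) := by
  have hmul : ∀ j, labelProjection L hL g j * labelProjection L hL g j =
      funcCalc L hL (fun l => quadPartition g j (√l) * quadPartition g j (√l)) := fun j =>
    (funcCalc_mul L hL (continuousOn_quadPartition hg j) (tendsto_quadPartition hg j)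
      (continuousOn_quadPartition hg j) (tendsto_quadPartition hg j)).symm
  induction n with
  | zero =>
    rw [zero_add, Finset.sum_range_one, hmul]
    refine funcCalc_congr L hL fun l _ => ?_
    rw [quadPartition_zero_mul_self hg (Real.sqrt_nonneg l)]
    simp
  | succ n ih =>
    have hc := continuousOn_quadPartition hg (n + 1)
    have ht := tendsto_quadPartition hg (n + 1)
    have ht2 : Filter.Tendsto (fun l => quadPartition g (n + 1) (√l) * quadPartition g (n + 1) (√l))
        Filter.atTop (nhds 0) := by simpa using ht.mul ht
    rw [Finset.sum_range_succ, ih, hmul, add_comm,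
      ← funcCalc_add L hL (hc.fun_mul hc) ht2 (continuousOn_dilation hg n)
        (tendsto_dilation hg n)]
    exact funcCalc_congr L hL fun l _ =>
      quadPartition_succ_mul_self hg n (Real.sqrt_nonneg l)

theorem norm_dilation_apply_le (n : ℕ) (x : H) :
    ‖funcCalc L hL (fun l => g ((2 ^ n)⁻¹ * √l)) x‖ ≤ ‖x‖ := by
  rw [← one_mul ‖x‖]
  refine norm_cfc_resolvent_apply_le L hL zero_le_one
    (fun s hs => abs_changeOfVariable_le (F := fun l => g ((2 ^ n)⁻¹ * l))
      (fun l _ => ?_) hs) x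
  have h : 0 ≤ (2 ^ n)⁻¹ * √l := by positivity
  rw [abs_of_nonneg (hg.nonneg h)]
  exact hg.le_one h

/-- On the range of `(1 + L)⁻¹` the operators `g(2 ^ (-n) √L)` converge to the identity at a
geometric rate, because `(1 + l)⁻¹` is small where `g(2 ^ (-n) √l) ≠ 1`. -/
theorem norm_dilation_resolvent_sub_le (n : ℕ) (y : H) :
    ‖funcCalc L hL (fun l => g ((2 ^ n)⁻¹ * √l)) (resolvent L hL y) - resolvent L hL y‖ ≤
      (1 / 2) ^ n * ‖y‖ := by
  have hR := resolvent_isSelfAdjoint L hL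
  have hsub := resolvent_spectrum L hL
  have hc : ContinuousOn (fun s : ℝ => if s = 0 then 0 else g ((2 ^ n)⁻¹ * √(s⁻¹ - 1)))
      (spectrum ℝ (resolvent L hL)) :=
    (continuousOn_changeOfVariable (continuousOn_dilation hg n) (tendsto_dilation hg n)).mono hsub
  have h1 : funcCalc L hL (fun l => g ((2 ^ n)⁻¹ * √l)) * resolvent L hL - resolvent L hL =
      cfc (fun s : ℝ => (if s = 0 then 0 else g ((2 ^ n)⁻¹ * √(s⁻¹ - 1))) * s - s)
        (resolvent L hL) := by
    rw [cfc_sub _ (fun s : ℝ => s) _ (hc.fun_mul (continuousOn_id' _)) continuousOn_id,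
      cfc_mul _ (fun s : ℝ => s) _ hc continuousOn_id, cfc_id' ℝ (resolvent L hL) hR]
    rfl
  have h2 := congrArg (fun T => T y) h1
  simp only [sub_apply, mul_apply_eq_comp] at h2
  rw [h2]
  refine norm_cfc_resolvent_apply_le L hL (by positivity) (fun s hs => ?_) y
  rcases hs.1.eq_or_lt with rfl | hpos
  · simp
  rw [if_neg hpos.ne']
  have hl0 : 0 ≤ s⁻¹ - 1 := sub_nonneg.2 ((one_le_inv₀ hpos).2 hs.2)
  have hn : 0 ≤ (2 ^ n)⁻¹ * √(s⁻¹ - 1) := by positivity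
  by_cases hl : (2 ^ n)⁻¹ * √(s⁻¹ - 1) ≤ 1
  · rw [hg.eq_one _ ⟨hn, hl⟩]
    simp
  · rw [not_le, lt_inv_mul_iff₀ (by positivity), mul_one, Real.lt_sqrt (by positivity)] at hl
    have h3 : s ≤ (1 / 2) ^ n := by
      rw [one_div, inv_pow]
      refine le_inv_of_le_inv₀ (by positivity) ?_
      have : (1 : ℝ) ≤ 2 ^ n := one_le_pow₀ one_le_two
      nlinarith
    have h4 := hg.nonneg hn
    have h5 := hg.le_one hn
    rw [abs_le]
    constructor <;> nlinarith

theorem tendsto_dilation_apply (x : H) :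
    Filter.Tendsto (fun n : ℕ => funcCalc L hL (fun l => g ((2 ^ n)⁻¹ * √l)) x)
      Filter.atTop (nhds x) := by
  have hdense : DenseRange (resolvent L hL) := by
    have h := ContinuousLinearMap.orthogonal_range (resolvent L hL)
    rw [← ContinuousLinearMap.star_eq_adjoint, (resolvent_isSelfAdjoint L hL).star_eq,
      LinearMap.ker_eq_bot.2 (resolvent_injective L hL),
      ← Submodule.topologicalClosure_eq_top_iff, ← Submodule.dense_iff_topologicalClosure_eq_top]
      at h
    exact h
  rw [Metric.tendsto_atTop]
  intro ε hε
  obtain ⟨y, hy⟩ := hdense.exists_dist_lt x (by positivity : 0 < ε / 3)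
  have hlim : Filter.Tendsto (fun n : ℕ => (1 / 2 : ℝ) ^ n * ‖y‖) Filter.atTop (nhds 0) := by
    simpa using (tendsto_pow_atTop_nhds_zero_of_lt_one (by norm_num : (0 : ℝ) ≤ 1 / 2)
      (by norm_num)).mul_const ‖y‖
  obtain ⟨N, hN⟩ := Filter.eventually_atTop.1
    (hlim.eventually_lt_const (by positivity : 0 < ε / 3))
  refine ⟨N, fun n hn => ?_⟩
  set T := funcCalc L hL (fun l => g ((2 ^ n)⁻¹ * √l)) with hT
  have h1 : ‖T (x - resolvent L hL y)‖ ≤ ‖x - resolvent L hL y‖ :=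
    norm_dilation_apply_le L hL hg n _
  have h2 : ‖T (resolvent L hL y) - resolvent L hL y‖ ≤ (1 / 2) ^ n * ‖y‖ :=
    norm_dilation_resolvent_sub_le L hL hg n y
  have h3 := hN n hn
  rw [dist_eq_norm] at hy ⊢
  have h4 : T x - x = T (x - resolvent L hL y) + (T (resolvent L hL y) - resolvent L hL y)
      - (x - resolvent L hL y) := by
    rw [map_sub]; abel
  rw [h4]
  have h5 := norm_sub_le (T (x - resolvent L hL y) + (T (resolvent L hL y) - resolvent L hL y))
    (x - resolvent L hL y)
  have h6 := norm_add_le (T (x - resolvent L hL y)) (T (resolvent L hL y) - resolvent L hL y)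
  linarith

/-- The Calderón reproducing formula `f = ∑ F_j(√L) F_j(√L) f`. -/
theorem tendsto_sum_labelProjection (f : H) :
    Filter.Tendsto (fun n : ℕ => ∑ j ∈ Finset.range n,
      labelProjection L hL g j (labelProjection L hL g j f)) Filter.atTop (nhds f) := by
  rw [← Filter.tendsto_add_atTop_iff_nat 1]
  refine (tendsto_dilation_apply L hL hg f).congr fun n => ?_
  rw [← sum_labelProjection_mul_self L hL hg]
  simp

/-- The remainder of the reproducing formula is controlled by the remaining frequencies. -/
theorem enorm_sub_sum_labelProjection_le (f : H) (N : ℕ) :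
    ‖f - ∑ j ∈ Finset.range N, labelProjection L hL g j (labelProjection L hL g j f)‖ₑ ≤
      ∑' j, if j < N then 0 else ‖labelProjection L hL g j f‖ₑ := by
  have hlim := ((tendsto_sum_labelProjection L hL hg f).sub_const
    (∑ j ∈ Finset.range N, labelProjection L hL g j (labelProjection L hL g j f))).enorm
  refine le_of_tendsto hlim ?_
  filter_upwards [Filter.eventually_ge_atTop N] with n hn
  rw [← Finset.sum_Ico_eq_sub _ hn]
  calc ‖∑ j ∈ Finset.Ico N n, labelProjection L hL g j (labelProjection L hL g j f)‖ₑ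
      ≤ ∑ j ∈ Finset.Ico N n, ‖labelProjection L hL g j (labelProjection L hL g j f)‖ₑ :=
        enorm_sum_le _ _
    _ ≤ ∑ j ∈ Finset.Ico N n, if j < N then 0 else ‖labelProjection L hL g j f‖ₑ := by
        refine Finset.sum_le_sum fun j hj => ?_
        rw [if_neg (not_lt.2 (Finset.mem_Ico.1 hj).1), enorm_le_iff_norm_le]
        exact labelProjection_norm_le L hL hg j _
    _ ≤ _ := ENNReal.sum_le_tsum _

end Projections

/-! ### The `K`-functional and the dyadic pieces -/

section Scales

theorem le_mul_kFunctional {E : Type*} [AddCommGroup E] {N₀ N₁ : E → ℝ≥0∞} {f : E} {t : ℝ}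
    {x C : ℝ≥0∞} (hC0 : C ≠ 0) (hC : C ≠ ∞)
    (h : ∀ f₀ f₁, f = f₀ + f₁ → x ≤ C * (N₀ f₀ + ENNReal.ofReal t * N₁ f₁)) :
    x ≤ C * kFunctional N₀ N₁ f t := by
  unfold kFunctional
  simp_rw [ENNReal.mul_iInf_of_ne hC0 hC]
  exact le_iInf fun f₀ => le_iInf fun f₁ => le_iInf fun hf => h f₀ f₁ hf

/-- The weight of the sample at `2 ^ (-n r)` is `2 ^ (n α)`. -/
theorem zpow_rpow_neg_div {r : ℕ} (hr : r ≠ 0) (α : ℝ) (n : ℤ) :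
    (((2 : ℝ) ^ r) ^ (-n)) ^ (-(α / r)) = 2 ^ (n * α) := by
  rw [← Real.rpow_natCast, ← Real.rpow_intCast, ← Real.rpow_mul zero_le_two,
    ← Real.rpow_mul zero_le_two]
  congr 1
  push_cast
  field_simp

/-- After multiplication by the weights `2 ^ (n α)`, the coefficients of the low frequencies `j ≤ n`
decay like `2 ^ (-(r - α) |n - j|)` and those of the high frequencies like `2 ^ (-α |n - j|)`. -/
theorem rpow_mul_scale_le {α : ℝ} {r : ℕ} (n : ℤ) (j : ℕ) :
    (2 : ℝ) ^ (n * α) * (if (j : ℤ) ≤ n then (2 ^ r) ^ ((j : ℤ) - n) else 1) ≤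
      (max (2 ^ (-α)) (2 ^ (α - r))) ^ (n - j).natAbs * 2 ^ (j * α) := by
  split_ifs with h
  · obtain ⟨d, rfl⟩ := Int.le.dest h
    have h1 : (2 : ℝ) ^ (((j + d : ℤ) : ℝ) * α) * (2 ^ r) ^ ((j : ℤ) - (j + d)) =
        (2 ^ (α - r)) ^ d * 2 ^ (j * α) := by
      rw [← Real.rpow_natCast, ← Real.rpow_natCast, ← Real.rpow_intCast,
        ← Real.rpow_mul zero_le_two, ← Real.rpow_mul zero_le_two, ← Real.rpow_add two_pos,
        ← Real.rpow_add two_pos]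
      congr 1
      push_cast
      ring
    rw [h1, add_sub_cancel_left, Int.natAbs_natCast]
    gcongr
    exact le_max_right _ _
  · obtain ⟨d, hd⟩ := Int.le.dest (not_le.1 h).le
    have h1 : (2 : ℝ) ^ (n * α) * 1 = (2 ^ (-α)) ^ d * 2 ^ (j * α) := by
      rw [mul_one, ← Real.rpow_natCast, ← Real.rpow_mul zero_le_two, ← Real.rpow_add two_pos]
      have hd' : (n : ℝ) + d = j := by exact_mod_cast hd
      rw [← hd']
      congr 1
      ring
    have h2 : (n - j).natAbs = d := by omega
    rw [h1, h2]
    gcongr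
    exact le_max_left _ _

end Scales

section Comparison

variable {H : Type*} [NormedAddCommGroup H] [InnerProductSpace ℂ H] [CompleteSpace H]
  (L : H →ₗ.[ℂ] H) (hL : IsNonnegSelfAdjoint L) {g : ℝ → ℝ} (hg : IsDyadicCutoff g)

include hg

theorem enorm_labelProjection_le_graphENorm (r j : ℕ) (f : H) :
    ‖labelProjection L hL g j f‖ₑ ≤
      ENNReal.ofReal (2 ^ r * (2 ^ r) ^ (-(j : ℤ))) * graphENorm (sqrtOp L hL) r f := by
  unfold graphENorm
  rw [ENNReal.mul_iInf_of_ne (by simp only [ne_eq, ENNReal.ofReal_eq_zero, not_le]; positivity)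
    ENNReal.ofReal_ne_top]
  refine le_iInf fun hf => ?_
  have hmem := (powOp (sqrtOp L hL) r).mem_graph ⟨f, hf⟩
  set z := powOp (sqrtOp L hL) r ⟨f, hf⟩
  rw [← ofReal_norm, ← ofReal_norm, ← ofReal_norm,
    ← ENNReal.ofReal_add (norm_nonneg _) (norm_nonneg _), ← ENNReal.ofReal_mul (by positivity)]
  refine ENNReal.ofReal_le_ofReal ?_
  cases j with
  | zero =>
    have h1 := labelProjection_norm_le L hL hg 0 f
    have h2 : (1 : ℝ) ≤ 2 ^ r := one_le_pow₀ one_le_two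
    simp only [Nat.cast_zero, neg_zero, zpow_zero, mul_one]
    nlinarith [norm_nonneg f, norm_nonneg z]
  | succ j =>
    have h1 := norm_labelProjection_succ_le L hL hg j hmem
    have h2 : (2 : ℝ) ^ r * (2 ^ r) ^ (-((j + 1 : ℕ) : ℤ)) = (2 ^ j)⁻¹ ^ r := by
      rw [zpow_neg, zpow_natCast, pow_succ, ← pow_mul, inv_pow, ← pow_mul, mul_comm j r]
      field_simp
    rw [h2]
    refine h1.trans ?_
    gcongr
    exact le_add_of_nonneg_left (norm_nonneg f)

/-- Each dyadic piece is dominated by the `K`-functional at the matching scale. -/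
theorem enorm_labelProjection_le_kFunctional (r j : ℕ) (f : H) :
    ‖labelProjection L hL g j f‖ₑ ≤ ENNReal.ofReal (2 ^ r) *
      kFunctional (fun f₀ => ‖f₀‖ₑ) (graphENorm (sqrtOp L hL) r) f ((2 ^ r) ^ (-(j : ℤ))) := by
  refine le_mul_kFunctional (by simp) ENNReal.ofReal_ne_top ?_
  rintro f₀ f₁ rfl
  rw [map_add, mul_add, ← mul_assoc, ← ENNReal.ofReal_mul (by positivity)]
  refine (enorm_add_le _ _).trans (add_le_add ?_
    (enorm_labelProjection_le_graphENorm L hL hg r j f₁))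
  calc ‖labelProjection L hL g j f₀‖ₑ ≤ 1 * ‖f₀‖ₑ := by
        rw [one_mul, enorm_le_iff_norm_le]
        exact labelProjection_norm_le L hL hg j f₀
    _ ≤ _ := by
        gcongr
        rw [ENNReal.one_le_ofReal]
        exact one_le_pow₀ one_le_two

theorem graphENorm_sum_labelProjection_le (r N : ℕ) (f : H) :
    graphENorm (sqrtOp L hL) r
        (∑ j ∈ Finset.range N, labelProjection L hL g j (labelProjection L hL g j f)) ≤
      ∑ j ∈ Finset.range N,
        ENNReal.ofReal (1 + (2 ^ (j + 1)) ^ r) * ‖labelProjection L hL g j f‖ₑ := by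
  choose z hz hzn using fun j =>
    exists_mem_graph_powOp_labelProjection L hL hg j r (labelProjection L hL g j f)
  have hmem : (∑ j ∈ Finset.range N, labelProjection L hL g j (labelProjection L hL g j f),
      ∑ j ∈ Finset.range N, z j) ∈ (powOp (sqrtOp L hL) r).graph := by
    have := Submodule.sum_mem (powOp (sqrtOp L hL) r).graph
      (fun j (_ : j ∈ Finset.range N) => hz j)
    convert this <;> simp [Prod.fst_sum, Prod.snd_sum]
  refine (graphENorm_le_of_mem_graph hmem).trans ?_
  refine (add_le_add (enorm_sum_le _ _) (enorm_sum_le _ _)).trans ?_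
  rw [← Finset.sum_add_distrib]
  refine Finset.sum_le_sum fun j _ => ?_
  rw [ENNReal.ofReal_add zero_le_one (by positivity), add_mul, ENNReal.ofReal_one, one_mul]
  refine add_le_add (enorm_le_iff_norm_le.2 (labelProjection_norm_le L hL hg j _)) ?_
  rw [← ofReal_norm, ← ofReal_norm, ← ENNReal.ofReal_mul (by positivity)]
  exact ENNReal.ofReal_le_ofReal (hzn j)

/-- The `K`-functional at scale `2 ^ (-n r)` is dominated by the dyadic pieces, by splitting `f`
at the frequency `2 ^ n`. For `n < 0` the low-frequency part is empty. -/
theorem kFunctional_le_tsum (r : ℕ) (n : ℤ) (f : H) :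
    kFunctional (fun f₀ => ‖f₀‖ₑ) (graphENorm (sqrtOp L hL) r) f ((2 ^ r) ^ (-n)) ≤
      ENNReal.ofReal (1 + 2 ^ r) *
        ∑' j : ℕ, ENNReal.ofReal (if (j : ℤ) ≤ n then (2 ^ r) ^ ((j : ℤ) - n) else 1) *
          ‖labelProjection L hL g j f‖ₑ := by
  set N := (n + 1).toNat with hN
  have hNj : ∀ j : ℕ, j < N ↔ (j : ℤ) ≤ n := fun j => by omega
  set f₁ := ∑ j ∈ Finset.range N, labelProjection L hL g j (labelProjection L hL g j f)
  set a : ℕ → ℝ≥0∞ := fun j => ‖labelProjection L hL g j f‖ₑ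
  set t : ℝ := (2 ^ r) ^ (-n) with ht
  have ht0 : 0 < t := by positivity
  have h1 : kFunctional (fun f₀ => ‖f₀‖ₑ) (graphENorm (sqrtOp L hL) r) f t ≤
      ‖f - f₁‖ₑ + ENNReal.ofReal t * graphENorm (sqrtOp L hL) r f₁ :=
    iInf_le_of_le (f - f₁) (iInf_le_of_le f₁ (iInf_le _ (sub_add_cancel f f₁).symm))
  have h2 : ENNReal.ofReal t * graphENorm (sqrtOp L hL) r f₁ ≤
      ∑' j, if j < N then ENNReal.ofReal (t * (1 + (2 ^ (j + 1)) ^ r)) * a j else 0 := by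
    calc ENNReal.ofReal t * graphENorm (sqrtOp L hL) r f₁
        ≤ ENNReal.ofReal t * ∑ j ∈ Finset.range N,
            ENNReal.ofReal (1 + (2 ^ (j + 1)) ^ r) * a j := by
          gcongr
          exact graphENorm_sum_labelProjection_le L hL hg r N f
      _ = ∑ j ∈ Finset.range N,
            if j < N then ENNReal.ofReal (t * (1 + (2 ^ (j + 1)) ^ r)) * a j else 0 := by
          rw [Finset.mul_sum]
          refine Finset.sum_congr rfl fun j hj => ?_
          rw [if_pos (Finset.mem_range.1 hj), ENNReal.ofReal_mul ht0.le, mul_assoc]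
      _ ≤ _ := ENNReal.sum_le_tsum _
  refine h1.trans ((add_le_add (enorm_sub_sum_labelProjection_le L hL hg f N) h2).trans ?_)
  rw [← ENNReal.tsum_add, ← ENNReal.tsum_mul_left]
  refine ENNReal.tsum_le_tsum fun j => ?_
  by_cases hj : j < N
  · rw [if_pos hj, if_pos hj, if_pos ((hNj j).1 hj), zero_add, ← mul_assoc,
      ← ENNReal.ofReal_mul (by positivity)]
    refine mul_le_mul' (ENNReal.ofReal_le_ofReal ?_) le_rfl
    rw [sub_eq_add_neg, zpow_add₀ (by positivity), ← ht, zpow_natCast, pow_succ, mul_pow,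
      ← pow_mul, ← pow_mul, mul_comm j r]
    have h3 : (1 : ℝ) ≤ 2 ^ (r * j) := one_le_pow₀ one_le_two
    calc t * (1 + 2 ^ (r * j) * 2 ^ r) ≤ t * (2 ^ (r * j) + 2 ^ (r * j) * 2 ^ r) := by gcongr
      _ = (1 + 2 ^ r) * (2 ^ (r * j) * t) := by ring
  · rw [if_neg hj, if_neg hj, if_neg (fun h => hj ((hNj j).2 h)), add_zero, ENNReal.ofReal_one,
      one_mul]
    refine le_mul_of_one_le_left' ?_
    rw [ENNReal.one_le_ofReal]
    exact le_add_of_nonneg_right (by positivity)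

/-- Half of the norm equivalence: the dyadic norm is bounded by the Besov norm. -/
theorem dyadicENorm_le_besovENorm {α : ℝ} (hα : 0 < α) {r : ℕ} (hr : α < r) {q : ℝ≥0∞}
    (hq : 1 ≤ q) :
    ∃ C : ℝ≥0∞, C ≠ ∞ ∧ ∀ f, dyadicENorm L hL g α q f ≤ C * besovENorm L hL r α q f := by
  have hr0 : 0 < (r : ℝ) := hα.trans hr
  have hrn : r ≠ 0 := by rintro rfl; simp at hr0
  obtain ⟨C, hC, h⟩ := kSample_le_interpolationENorm
    (one_lt_pow₀ (one_lt_two : (1 : ℝ) < 2) hrn)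
    (div_pos hα hr0) hq (fun f₀ : H => ‖f₀‖ₑ) (graphENorm (sqrtOp L hL) r)
  refine ⟨ENNReal.ofReal (2 ^ r) * C, by finiteness, fun f => ?_⟩
  set A := kSample (fun f₀ : H => ‖f₀‖ₑ) (graphENorm (sqrtOp L hL) r) (α / r) (2 ^ r) f with hA
  calc dyadicENorm L hL g α q f
      ≤ lqENorm q (fun j : ℕ => ENNReal.ofReal (2 ^ r) * A (-(j : ℤ))) := by
        refine lqENorm_mono fun j => ?_
        rw [hA, kSample, zpow_rpow_neg_div hrn, mul_left_comm, Int.cast_natCast]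
        gcongr
        exact enorm_labelProjection_le_kFunctional L hL hg r j f
    _ ≤ ENNReal.ofReal (2 ^ r) * lqENorm q A := by
        rw [lqENorm_const_mul hq]
        gcongr
        exact lqENorm_comp_le_of_injective (e := fun j : ℕ => -(j : ℤ))
          (fun i j hij => by simpa using hij) A
    _ ≤ ENNReal.ofReal (2 ^ r) * C * besovENorm L hL r α q f := by
        rw [mul_assoc]
        gcongr
        exact h f

/-- Half of the norm equivalence: the Besov norm is bounded by the dyadic norm. -/
theorem besovENorm_le_dyadicENorm {α : ℝ} (hα : 0 < α) {r : ℕ} (hr : α < r) {q : ℝ≥0∞}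
    (hq : 1 ≤ q) :
    ∃ C : ℝ≥0∞, C ≠ ∞ ∧ ∀ f, besovENorm L hL r α q f ≤ C * dyadicENorm L hL g α q f := by
  have hr0 : 0 < (r : ℝ) := hα.trans hr
  have hrn : r ≠ 0 := by rintro rfl; simp at hr0
  obtain ⟨C, hC, h⟩ := interpolationENorm_le_kSample
    (one_lt_pow₀ (one_lt_two : (1 : ℝ) < 2) hrn)
    (div_pos hα hr0) hq (fun f₀ : H => ‖f₀‖ₑ) (graphENorm (sqrtOp L hL) r)
  -- The rate of decay off the diagonal; both entries are `< 1` because `0 < α < r`.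
  set ρ : ℝ := max (2 ^ (-α)) (2 ^ (α - r)) with hρ
  have hρ0 : 0 ≤ ρ := le_max_of_le_left (by positivity)
  have hρ1 : ENNReal.ofReal ρ < 1 := by
    rw [ENNReal.ofReal_lt_one, hρ, max_lt_iff]
    exact ⟨Real.rpow_lt_one_of_one_lt_of_neg one_lt_two (by linarith),
      Real.rpow_lt_one_of_one_lt_of_neg one_lt_two (by linarith)⟩
  set W := ∑' m : ℤ, ENNReal.ofReal ρ ^ m.natAbs with hW
  have hWtop : W ≠ ∞ := (tsum_pow_natAbs_lt_top hρ1).ne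
  refine ⟨C * (ENNReal.ofReal (1 + 2 ^ r) * W), by finiteness, fun f => ?_⟩
  set a : ℕ → ℝ≥0∞ := fun j => ENNReal.ofReal (2 ^ (j * α)) * ‖labelProjection L hL g j f‖ₑ
    with ha
  set A := kSample (fun f₀ : H => ‖f₀‖ₑ) (graphENorm (sqrtOp L hL) r) (α / r) (2 ^ r) f with hA
  have hAle : ∀ m : ℤ, A m ≤ ENNReal.ofReal (1 + 2 ^ r) *
      ∑' j : ℕ, ENNReal.ofReal ρ ^ (-m - j).natAbs * a j := fun m => by
    obtain ⟨n, rfl⟩ : ∃ n, m = -n := ⟨-m, (neg_neg m).symm⟩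
    rw [hA, kSample, zpow_rpow_neg_div hrn, neg_neg]
    refine (mul_le_mul' le_rfl (kFunctional_le_tsum L hL hg r n f)).trans ?_
    rw [mul_left_comm, ← ENNReal.tsum_mul_left]
    refine mul_le_mul' le_rfl (ENNReal.tsum_le_tsum fun j => ?_)
    rw [ha, ← mul_assoc, ← mul_assoc, ← ENNReal.ofReal_pow hρ0,
      ← ENNReal.ofReal_mul (by positivity), ← ENNReal.ofReal_mul (by positivity)]
    exact mul_le_mul' (ENNReal.ofReal_le_ofReal (rpow_mul_scale_le n j)) le_rfl
  calc besovENorm L hL r α q f ≤ C * lqENorm q A := h f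
    _ ≤ C * (ENNReal.ofReal (1 + 2 ^ r) * (W * lqENorm q a)) := by
        gcongr
        refine (lqENorm_mono hAle).trans ?_
        rw [lqENorm_const_mul hq]
        gcongr
        refine lqENorm_tsum_mul_le hq (fun m => ?_) (fun j => ?_) a
        · exact ENNReal.tsum_comp_le_tsum_of_injective (f := fun j : ℕ => -m - (j : ℤ))
            (fun i j hij => by simpa using hij) (fun m => ENNReal.ofReal ρ ^ m.natAbs)
        · exact ENNReal.tsum_comp_le_tsum_of_injective (f := fun m : ℤ => -m - (j : ℤ))
            (fun i j hij => by simpa using hij) (fun m => ENNReal.ofReal ρ ^ m.natAbs)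
    _ = C * (ENNReal.ofReal (1 + 2 ^ r) * W) * dyadicENorm L hL g α q f := by
        rw [mul_assoc, mul_assoc]
        rfl

end Comparison

end SpectralBesov

theorem theorem7p4 {H : Type*} [NormedAddCommGroup H] [InnerProductSpace ℂ H] [CompleteSpace H]
    (L : H →ₗ.[ℂ] H) (hL : IsNonnegSelfAdjoint L) (g : ℝ → ℝ) (hg : IsDyadicCutoff g)
    (α : ℝ) (hα : 0 < α) (r : ℕ) (hr : α < r) (q : ℝ≥0∞) (hq : 1 ≤ q) :
    ∃ c C : ℝ, 0 < c ∧ 0 < C ∧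
      (∀ f : H, f ∈ besovSpace L hL r α q ↔ dyadicENorm L hL g α q f < ∞) ∧
      ∀ f ∈ besovSpace L hL r α q,
        ENNReal.ofReal c * besovENorm L hL r α q f ≤ dyadicENorm L hL g α q f ∧
        dyadicENorm L hL g α q f ≤ ENNReal.ofReal C * besovENorm L hL r α q f := by
  obtain ⟨C₁, hC₁, h₁⟩ := dyadicENorm_le_besovENorm L hL hg hα hr hq
  obtain ⟨C₂, hC₂, h₂⟩ := besovENorm_le_dyadicENorm L hL hg hα hr hq
  -- Adding `1` makes the constants positive.
  have hpos : ∀ C : ℝ≥0∞, 0 < C.toReal + 1 := fun C => by positivity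
  have hle : ∀ C : ℝ≥0∞, C ≠ ∞ → C ≤ ENNReal.ofReal (C.toReal + 1) := fun C hC =>
    ENNReal.le_ofReal_iff_toReal_le hC (hpos C).le |>.2 (le_add_of_nonneg_right zero_le_one)
  refine ⟨(C₂.toReal + 1)⁻¹, C₁.toReal + 1, inv_pos.2 (hpos C₂), hpos C₁, fun f => ⟨fun hf => ?_,
    fun hf => ?_⟩, fun f _ => ⟨?_, (h₁ f).trans (mul_le_mul' (hle C₁ hC₁) le_rfl)⟩⟩
  · exact (h₁ f).trans_lt (ENNReal.mul_lt_top hC₁.lt_top hf)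
  · exact (h₂ f).trans_lt (ENNReal.mul_lt_top hC₂.lt_top hf)
  · rw [ENNReal.ofReal_inv_of_pos (hpos C₂), ENNReal.inv_mul_le_iff
      (by simpa using hpos C₂) ENNReal.ofReal_ne_top]
    exact (h₂ f).trans (mul_le_mul' (hle C₂ hC₂) le_rfl)
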